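/- Let $d\in\mathbb N$, $T>0$, $\sigma>0$, and let $\beta:[0,T]\to(0,\infty)$ be continuous and non-decreasing. Let $\pi_{\rm data}$ be a probability distribution on $\mathbb R^d$ with a Lebesgue density, also denoted $\pi_{\rm data}$, and let $(X_t)_{t\in[0,T]}$ be a continuous solution of $$\mathrm dX_t=-\frac{\beta(t)}{2\sigma^2}X_t\,\mathrm dt+\sqrt{\beta(t)}\,\mathrm dB_t,\qquad X_0\sim\pi_{\rm data},$$ where $B$ is a standard Brownian motion in $\mathbb R^d$ independent of $X_0$. Let $\varphi_{\sigma^2}$ be the density of the Gaussian distribution $\mathcal N(0,\sigma^2 I_d)$, and put $$m_t=\exp\Big(-\frac1{2\sigma^2}\int_0^t\beta(s)\,\mathrm ds\Big),\qquad C_t=\frac{1}{m_t^2/C_*+\sigma^2(1-m_t^2)}-\frac1{\sigma^2}.$$ A function $h:\mathbb R^d\to[-\infty,\infty)$ is called $C$-strongly concave if the set $\{h>-\infty\}$ is convex and $h((1-s)x+sy)\ge(1-s)h(x)+s\,h(y)+\frac C2 s(1-s)\|x-y\|^2$ for all $x,y$ in that set and all $s\in[0,1]$. Assume that $\log\pi_{\rm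 data}$ is $C_*$-strongly concave (with $\log 0=-\infty$) for some $C_*>1/\sigma^2$. Then: 1. For every $t\in(0,T]$, the law of $X_t$ has an everywhere positive and differentiable Lebesgue density $p_t$ on $\mathbb R^d$, and, with $\tilde p_t:=p_t/\varphi_{\sigma^2}$, the function $\log\tilde p_t$ is $C_t$-strongly concave on $\mathbb R^d$; moreover $$\big(\nabla\log\tilde p_t(y)-\nabla\log\tilde p_t(x)\big)^\top(x-y)\ \ge\ C_t\|x-y\|^2\qquad\text{for all }x,y\in\mathbb R^d.$$ 2. For $t=0$, $\log\tilde p_0$ with $\tilde p_0:=\pi_{\rm data}/\varphi_{\sigma^2}$ is $C_0$-strongly concave. 3. For every $t\in[0,T]$, $0\le C_t\le C_*-1/\sigma^2$. -/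

import Mathlib

open MeasureTheory ProbabilityTheory Filter Set
open scoped NNReal ENNReal Topology

/-- A standard Brownian motion in `ℝ^d`: the coordinates are independent real Brownian motions. -/
structure IsBrownianMotion {Ω : Type*} [MeasurableSpace Ω] {d : ℕ}
    (B : ℝ≥0 → Ω → EuclideanSpace ℝ (Fin d)) (P : Measure Ω) : Prop where
  measurable : ∀ t, Measurable (B t)
  coord : ∀ i, IsBrownianReal (fun t ω => B t ω i) P
  indep : iIndepFun (fun (i : Fin d) (ω : Ω) (t : ℝ≥0) => B t ω i) P

/-- The left-point sum of `f` against the increments of `B` along the partition of `[0, t]` into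
`n` intervals of equal length. -/
noncomputable def itoSum {Ω : Type*} {d : ℕ} (f : ℝ → ℝ)
    (B : ℝ≥0 → Ω → EuclideanSpace ℝ (Fin d)) (t : ℝ) (n : ℕ) (ω : Ω) :
    EuclideanSpace ℝ (Fin d) :=
  ∑ k ∈ Finset.range n, f (t * k / n) •
    (B (Real.toNNReal (t * (k + 1) / n)) ω - B (Real.toNNReal (t * k / n)) ω)

/-- `I = ∫₀ᵗ f(s) dB_s`, the Itô integral of a deterministic integrand `f` that is continuous on
`[0, t]`: the limit in probability of the left-point sums. -/
def IsItoIntegral {Ω : Type*} [MeasurableSpace Ω] {d : ℕ} (f : ℝ → ℝ)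
    (B : ℝ≥0 → Ω → EuclideanSpace ℝ (Fin d)) (t : ℝ) (I : Ω → EuclideanSpace ℝ (Fin d))
    (P : Measure Ω) : Prop :=
  TendstoInMeasure P (fun n => itoSum f B t n) atTop I

/-- `X` solves, on `[0, T]` and with respect to the Brownian motion `B`, the stochastic differential
equation `dX_t = -(β(t) / (2σ²)) X_t dt + √β(t) dB_t` with `X_0` of law `π₀` and independent
of `B`. -/
structure IsForwardProcess {Ω : Type*} [MeasurableSpace Ω] {d : ℕ} (T σ : ℝ) (β : ℝ → ℝ)
    (π₀ : Measure (EuclideanSpace ℝ (Fin d))) (B : ℝ≥0 → Ω → EuclideanSpace ℝ (Fin d))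
    (X : ℝ → Ω → EuclideanSpace ℝ (Fin d)) (P : Measure Ω) : Prop where
  brownian : IsBrownianMotion B P
  measurable : ∀ t ∈ Icc 0 T, Measurable (X t)
  continuous : ∀ᵐ ω ∂P, ContinuousOn (fun t => X t ω) (Icc 0 T)
  initial : HasLaw (X 0) π₀ P
  indep : IndepFun (X 0) (fun (ω : Ω) (t : ℝ≥0) => B t ω) P
  sde : ∀ t ∈ Icc 0 T, ∃ I : Ω → EuclideanSpace ℝ (Fin d),
    IsItoIntegral (fun s => Real.sqrt (β s)) B t I P ∧
    ∀ᵐ ω ∂P, X t ω = X 0 ω - (∫ s in (0 : ℝ)..t, (β s / (2 * σ ^ 2)) • X s ω) + I ω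

/-- The measure on `ℝ^d` with Lebesgue density `p`. -/
noncomputable def densityMeasure {d : ℕ} (p : EuclideanSpace ℝ (Fin d) → ℝ) :
    Measure (EuclideanSpace ℝ (Fin d)) :=
  volume.withDensity (fun x => ENNReal.ofReal (p x))

/-- `log p` is `C`-strongly concave, where `p ≥ 0` may vanish and `log 0 = -∞`: the set `{p > 0}` is
convex, and `log p` is `C`-strongly concave on it. -/
def IsStronglyLogConcave {d : ℕ} (C : ℝ) (p : EuclideanSpace ℝ (Fin d) → ℝ) : Prop :=
  (∀ x, 0 ≤ p x) ∧ StrongConcaveOn {x | 0 < p x} C (fun x => Real.log (p x))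

/-- The density of the Gaussian distribution with mean `0` and covariance `σ² I_d`. -/
noncomputable def gaussianDensity {d : ℕ} (σ : ℝ) (x : EuclideanSpace ℝ (Fin d)) : ℝ :=
  (2 * Real.pi * σ ^ 2) ^ (-(d : ℝ) / 2) * Real.exp (-‖x‖ ^ 2 / (2 * σ ^ 2))

/-- The density `p` divided by the density of the stationary distribution. -/
noncomputable def renormalized {d : ℕ} (σ : ℝ) (p : EuclideanSpace ℝ (Fin d) → ℝ)
    (x : EuclideanSpace ℝ (Fin d)) : ℝ :=
  p x / gaussianDensity σ x

/-- `m_t = exp (-(1 / (2σ²)) ∫₀ᵗ β(s) ds)`. -/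
noncomputable def meanScale (σ : ℝ) (β : ℝ → ℝ) (t : ℝ) : ℝ :=
  Real.exp (-(1 / (2 * σ ^ 2)) * ∫ s in (0 : ℝ)..t, β s)

/-- `C_t = 1 / (m_t² / C + σ² (1 - m_t²)) - 1 / σ²`. -/
noncomputable def concavityConst (σ : ℝ) (β : ℝ → ℝ) (C : ℝ) (t : ℝ) : ℝ :=
  1 / (meanScale σ β t ^ 2 / C + σ ^ 2 * (1 - meanScale σ β t ^ 2)) - 1 / σ ^ 2

/-! # Strong log-concavity along the forward Ornstein–Uhlenbeck process

The equation is linear, so it can be integrated by the factor `1 / m_t`: formally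
`X_t / m_t = X_0 + ∫₀ᵗ (√β / m) dB`. Hence `X_t` has the law of `m_t X_0 + Z` with an independent
`Z ∼ 𝒩(0, σ² (1 - m_t²) I)`. To make this precise, `noisePart` recovers a continuous version of
`∫ √β dB` from the equation itself. Summation by parts along a continuous path
(`tendsto_sum_smul_noisePart`) shows that `X_t / m_t - X_0` is the limit of the sums of increments of
the noise part weighted by `1 / m` at the left endpoints. For a fixed partition such a sum is a limit
of weighted sums of independent Brownian increments, which determines its characteristic function
(`IsForwardProcess.charFun_map_add_sum`); refining the partition gives
`IsForwardProcess.charFun_map`. Comparison of characteristic functions identifies the law of `X_t` as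
the measure with density `smoothedDensity`, which is positive and differentiable because it is an
average of translates of a Gaussian density.

For the concavity, write this density as `x ↦ ∫ p₀(y) g(x - m y) dy`, where `g` is the density of `Z`,
and put `s² = σ² (1 - m²)`, `K = 1 / (m² / C + s²)`. The quadratic form `C ‖y‖² + ‖x - m y‖² / s²` is
at least `K ‖x‖²` (`mul_norm_sq_le_of_smul`), so `p₀(y) g(x - m y) exp (K ‖x‖² / 2)` is jointly
log-concave in `(x, y)`. By the Prékopa–Leindler inequality (`prekopa_leindler`) its marginal in `x`
is log-concave, which says that the density of `X_t` is `K`-strongly log-concave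
(`strongConcaveOn_log_smoothedDensity`). Dividing by the density of `𝒩(0, σ² I)` adds
`‖x‖² / (2σ²)` to the logarithm, hence lowers the constant to `K - 1 / σ² = C_t`. The inequality for
the gradients is the monotonicity of the derivative of a concave function along segments.

The Prékopa–Leindler inequality is proved by induction on the dimension. On `ℝ`, the superlevel sets
of `h` contain the combinations of those of `f` and `g`, and the one-dimensional Brunn–Minkowski
inequality is integrated over the levels.
-/

/-! ### The Prékopa–Leindler inequality -/

/-- One-dimensional Brunn–Minkowski inequality for compact sets. With `a = max A` and `b = min B`,
the translates `A + b` and `a + B` lie in `A + B` and meet only at `a + b`. -/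
theorem volume_add_volume_le_of_isCompact {A B C : Set ℝ} (hA : IsCompact A) (hB : IsCompact B)
    (hA' : A.Nonempty) (hB' : B.Nonempty) (h : ∀ x ∈ A, ∀ y ∈ B, x + y ∈ C) :
    volume A + volume B ≤ volume C := by
  have ha := hA.sSup_mem hA'
  have hb := hB.sInf_mem hB'
  set a := sSup A
  set b := sInf B
  have h1 : volume ((fun x => x + b) '' A) = volume A := by
    rw [image_add_right, measure_preimage_add_right]
  have h2 : volume ((fun x => a + x) '' B) = volume B := by
    rw [image_add_left, measure_preimage_add]
  have hd : AEDisjoint volume ((fun x => x + b) '' A) ((fun x => a + x) '' B) := by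
    refine measure_mono_null (t := {a + b}) ?_ (by simp)
    rintro _ ⟨⟨x, hx, rfl⟩, ⟨y, hy, hxy⟩⟩
    have hx' : x ≤ a := le_csSup hA.bddAbove hx
    have hy' : b ≤ y := csInf_le hB.bddBelow hy
    have hxy : a + y = x + b := hxy
    simp only [mem_singleton_iff]
    linarith
  have hm : NullMeasurableSet ((fun x => a + x) '' B) volume :=
    (hB.image (by fun_prop)).measurableSet.nullMeasurableSet
  rw [← h1, ← h2, ← measure_union₀ hm hd]
  refine measure_mono ?_
  rintro _ (⟨x, hx, rfl⟩ | ⟨y, hy, rfl⟩)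
  · exact h x hx b hb
  · exact h a ha y hy

/-- One-dimensional Brunn–Minkowski inequality for measurable sets, by inner regularity. -/
theorem volume_add_volume_le {A B C : Set ℝ} (hA : MeasurableSet A) (hB : MeasurableSet B)
    (hA' : A.Nonempty) (hB' : B.Nonempty) (h : ∀ x ∈ A, ∀ y ∈ B, x + y ∈ C) :
    volume A + volume B ≤ volume C := by
  obtain ⟨x₀, hx₀⟩ := hA'
  obtain ⟨y₀, hy₀⟩ := hB'
  rw [hA.measure_eq_iSup_isCompact, hB.measure_eq_iSup_isCompact]
  simp only [iSup_and', iSup_subtype']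
  have : Nonempty {K : Set ℝ // K ⊆ A ∧ IsCompact K} := ⟨⟨∅, by simp⟩⟩
  have : Nonempty {K : Set ℝ // K ⊆ B ∧ IsCompact K} := ⟨⟨∅, by simp⟩⟩
  refine ENNReal.iSup_add_iSup_le ?_
  rintro ⟨K, hK, hKc⟩ ⟨L, hL, hLc⟩
  -- a point is adjoined to each compact set so that neither is empty
  have hK' : insert x₀ K ⊆ A := insert_subset hx₀ hK
  have hL' : insert y₀ L ⊆ B := insert_subset hy₀ hL
  calc volume K + volume L ≤ volume (insert x₀ K) + volume (insert y₀ L) :=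
        add_le_add (measure_mono (subset_insert _ _)) (measure_mono (subset_insert _ _))
    _ ≤ volume C := volume_add_volume_le_of_isCompact (hKc.insert _) (hLc.insert _)
        (insert_nonempty _ _) (insert_nonempty _ _) fun x hx y hy => h x (hK' hx) y (hL' hy)

open scoped Pointwise in
theorem mul_volume_add_mul_volume_le {A B C : Set ℝ} {a b : ℝ} (ha : 0 < a) (hb : 0 < b)
    (hA : MeasurableSet A) (hB : MeasurableSet B) (hA' : A.Nonempty) (hB' : B.Nonempty)
    (h : ∀ x ∈ A, ∀ y ∈ B, a * x + b * y ∈ C) :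
    ENNReal.ofReal a * volume A + ENNReal.ofReal b * volume B ≤ volume C := by
  have h1 : volume (a • A) = ENNReal.ofReal a * volume A := by
    rw [Measure.addHaar_smul]; simp [abs_of_pos ha]
  have h2 : volume (b • B) = ENNReal.ofReal b * volume B := by
    rw [Measure.addHaar_smul]; simp [abs_of_pos hb]
  rw [← h1, ← h2]
  refine volume_add_volume_le (hA.const_smul₀ a) (hB.const_smul₀ b) (hA'.smul_set) (hB'.smul_set) ?_
  rintro _ ⟨x, hx, rfl⟩ _ ⟨y, hy, rfl⟩
  simpa using h x hx y hy

/-- The additive form of the Prékopa–Leindler inequality on `ℝ`, for functions normalised to have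
supremum `1`: the superlevel sets of `h` contain the combinations of those of `f` and `g`. -/
theorem lintegral_add_lintegral_le_of_normalized {a b : ℝ} (ha : 0 < a) (hb : 0 < b)
    (hab : a + b = 1) {f g h : ℝ → ℝ} (hf : Measurable f) (hg : Measurable g) (hh : Measurable h)
    (hf0 : ∀ x, 0 ≤ f x) (hg0 : ∀ x, 0 ≤ g x) (hh0 : ∀ x, 0 ≤ h x)
    (hf1 : ∀ x, f x ≤ 1) (hg1 : ∀ x, g x ≤ 1)
    (hfs : ∀ r > 0, r < 1 → ∃ x, r < f x) (hgs : ∀ r > 0, r < 1 → ∃ x, r < g x)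
    (H : ∀ x y, f x ^ a * g y ^ b ≤ h (a * x + b * y)) :
    ENNReal.ofReal a * (∫⁻ x, ENNReal.ofReal (f x)) +
      ENNReal.ofReal b * (∫⁻ x, ENNReal.ofReal (g x)) ≤ ∫⁻ x, ENNReal.ofReal (h x) := by
  have meas : ∀ u : ℝ → ℝ, Measurable fun t => volume {x : ℝ | t < u x} := fun u =>
    Antitone.measurable fun s t hst => measure_mono fun x (hx : t < u x) => lt_of_le_of_lt hst hx
  rw [lintegral_eq_lintegral_meas_lt _ (Eventually.of_forall hf0) hf.aemeasurable,
    lintegral_eq_lintegral_meas_lt _ (Eventually.of_forall hg0) hg.aemeasurable,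
    lintegral_eq_lintegral_meas_lt _ (Eventually.of_forall hh0) hh.aemeasurable,
    ← lintegral_const_mul _ (meas f), ← lintegral_const_mul _ (meas g),
    ← lintegral_add_left ((meas f).const_mul _)]
  refine setLIntegral_mono' measurableSet_Ioi fun r (hr : 0 < r) => ?_
  rcases lt_or_ge r 1 with hr1 | hr1
  · refine mul_volume_add_mul_volume_le ha hb (measurableSet_lt measurable_const hf)
      (measurableSet_lt measurable_const hg) (hfs r hr hr1) (hgs r hr hr1) ?_
    intro x hx y hy
    refine lt_of_lt_of_le ?_ (H x y)
    calc r = r ^ a * r ^ b := by rw [← Real.rpow_add hr, hab, Real.rpow_one]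
      _ < f x ^ a * g y ^ b := mul_lt_mul'' (Real.rpow_lt_rpow hr.le hx ha)
          (Real.rpow_lt_rpow hr.le hy hb) (by positivity) (by positivity)
  · have e : ∀ u : ℝ → ℝ, (∀ x, u x ≤ 1) → {x : ℝ | r < u x} = ∅ := fun u hu =>
      eq_empty_of_forall_notMem fun x hx => absurd hx (not_lt.2 ((hu x).trans hr1))
    simp [e f hf1, e g hg1]

theorem ENNReal.rpow_mul_rpow_le_add {a b : ℝ} (ha : 0 < a) (hb : 0 < b) (hab : a + b = 1)
    (x y : ℝ≥0∞) :
    x ^ a * y ^ b ≤ ENNReal.ofReal a * x + ENNReal.ofReal b * y := by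
  rcases eq_or_ne x ⊤ with rfl | hx
  · simp [ENNReal.mul_top, ha]
  rcases eq_or_ne y ⊤ with rfl | hy
  · simp [ENNReal.mul_top, hb]
  have h := Real.geom_mean_le_arith_mean2_weighted ha.le hb.le (ENNReal.toReal_nonneg (a := x))
    (ENNReal.toReal_nonneg (a := y)) hab
  have h' := ENNReal.ofReal_le_ofReal h
  rwa [ENNReal.ofReal_mul (by positivity), ENNReal.ofReal_add (by positivity) (by positivity),
    ENNReal.ofReal_mul ha.le, ENNReal.ofReal_mul hb.le,
    ← ENNReal.ofReal_rpow_of_nonneg ENNReal.toReal_nonneg ha.le,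
    ← ENNReal.ofReal_rpow_of_nonneg ENNReal.toReal_nonneg hb.le,
    ENNReal.ofReal_toReal hx, ENNReal.ofReal_toReal hy] at h'

/-- The Prékopa–Leindler inequality on `ℝ` for bounded functions, reduced to the normalised case by
dividing by the suprema. -/
theorem prekopa_leindler_real_of_bounded {a b : ℝ} (ha : 0 < a) (hb : 0 < b) (hab : a + b = 1)
    {f g h : ℝ → ℝ≥0∞} (hf : Measurable f) (hg : Measurable g) (hh : Measurable h)
    (hf1 : ⨆ x, f x ≠ ⊤) (hg1 : ⨆ x, g x ≠ ⊤)
    (H : ∀ x y, f x ^ a * g y ^ b ≤ h (a * x + b * y)) :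
    (∫⁻ x, f x) ^ a * (∫⁻ x, g x) ^ b ≤ ∫⁻ x, h x := by
  set α := ⨆ x, f x with hα
  set γ := ⨆ x, g x with hγ
  rcases eq_or_ne α 0 with h0 | hα0
  · have : ∀ x, f x = 0 := fun x => le_zero_iff.1 (h0 ▸ le_iSup f x)
    simp [this, ENNReal.zero_rpow_of_pos ha]
  rcases eq_or_ne γ 0 with h0 | hγ0
  · have : ∀ x, g x = 0 := fun x => le_zero_iff.1 (h0 ▸ le_iSup g x)
    simp [this, ENNReal.zero_rpow_of_pos hb]
  set δ := α ^ a * γ ^ b with hδ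
  have hδ0 : δ ≠ 0 := by
    simp [hδ, hα0, hγ0, ENNReal.rpow_eq_zero_iff, ha.not_gt, hb.not_gt]
  have hα' : α ^ a ≠ 0 := left_ne_zero_of_mul hδ0
  have hγ' : γ ^ b ≠ 0 := right_ne_zero_of_mul hδ0
  have hα'' : α ^ a ≠ ⊤ := ENNReal.rpow_ne_top_of_nonneg ha.le hf1
  have hγ'' : γ ^ b ≠ ⊤ := ENNReal.rpow_ne_top_of_nonneg hb.le hg1
  have hδ1 : δ ≠ ⊤ := ENNReal.mul_ne_top hα'' hγ''
  -- the normalised functions `u / sup u` are at most `1` and come arbitrarily close to `1`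
  have bdd : ∀ (u : ℝ → ℝ≥0∞) (c : ℝ≥0∞), c = ⨆ x, u x → ∀ x, u x / c ≤ 1 :=
    fun u c hc x => ENNReal.div_le_of_le_mul (by rw [one_mul, hc]; exact le_iSup u x)
  have near : ∀ (u : ℝ → ℝ≥0∞) (c : ℝ≥0∞), c = ⨆ x, u x → c ≠ ⊤ → c ≠ 0 →
      ∀ r > 0, r < (1 : ℝ) → ∃ x, r < (u x / c).toReal := by
    intro u c hc hc1 hc0 r hr0 hr
    have : ENNReal.ofReal r * c < ⨆ x, u x := by
      rw [← hc]
      calc ENNReal.ofReal r * c < 1 * c :=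
            (ENNReal.mul_lt_mul_iff_left hc0 hc1).2 (by simpa using hr)
        _ = c := one_mul c
    obtain ⟨x, hx⟩ := lt_iSup_iff.1 this
    refine ⟨x, ?_⟩
    have h1 : ENNReal.ofReal r < u x / c :=
      (ENNReal.lt_div_iff_mul_lt (Or.inl hc0) (Or.inl hc1)).2 hx
    exact (ENNReal.ofReal_lt_iff_lt_toReal hr0.le
      (ne_top_of_le_ne_top ENNReal.one_ne_top (bdd u c hc x))).1 h1
  have key := lintegral_add_lintegral_le_of_normalized ha hb hab
    (f := fun x => (f x / α).toReal) (g := fun x => (g x / γ).toReal)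
    -- truncated at `1` because `h` may be infinite
    (h := fun x => (min (h x / δ) 1).toReal)
    (hf.div_const _).ennreal_toReal (hg.div_const _).ennreal_toReal
    ((hh.div_const _).min measurable_const).ennreal_toReal
    (fun _ => ENNReal.toReal_nonneg) (fun _ => ENNReal.toReal_nonneg)
    (fun _ => ENNReal.toReal_nonneg)
    (fun x => ENNReal.toReal_le_of_le_ofReal zero_le_one (by simpa using bdd f α hα x))
    (fun x => ENNReal.toReal_le_of_le_ofReal zero_le_one (by simpa using bdd g γ hγ x))
    (near f α hα hf1 hα0) (near g γ hγ hg1 hγ0) ?_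
  · have top : ∀ x : ℝ≥0∞, x ≤ 1 → ENNReal.ofReal x.toReal = x := fun x hx =>
      ENNReal.ofReal_toReal (ne_top_of_le_ne_top ENNReal.one_ne_top hx)
    simp_rw [top _ (bdd f α hα _), top _ (bdd g γ hγ _),
      top _ (min_le_right _ _)] at key
    have e : ∀ (u : ℝ → ℝ≥0∞) (c : ℝ≥0∞), Measurable u → ∫⁻ x, u x / c = (∫⁻ x, u x) / c :=
      fun u c hu => by simp_rw [div_eq_mul_inv]; rw [lintegral_mul_const _ hu]
    rw [e f α hf, e g γ hg] at key
    have h3 := (ENNReal.rpow_mul_rpow_le_add ha hb hab _ _).trans (key.trans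
      (lintegral_mono fun x => min_le_left (h x / δ) 1))
    rw [e h δ hh, ENNReal.div_rpow_of_nonneg _ _ ha.le, ENNReal.div_rpow_of_nonneg _ _ hb.le] at h3
    rw [ENNReal.le_div_iff_mul_le (Or.inl hδ0) (Or.inl hδ1)] at h3
    refine le_trans (le_of_eq ?_) h3
    rw [hδ, mul_mul_mul_comm, ENNReal.div_mul_cancel hα' hα'', ENNReal.div_mul_cancel hγ' hγ'']
  · intro x y
    simp only [ENNReal.toReal_rpow, ← ENNReal.toReal_mul]
    refine ENNReal.toReal_mono (ne_top_of_le_ne_top ENNReal.one_ne_top (min_le_right _ _)) ?_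
    refine le_min ?_ ?_
    · rw [ENNReal.div_rpow_of_nonneg _ _ ha.le, ENNReal.div_rpow_of_nonneg _ _ hb.le,
        ENNReal.le_div_iff_mul_le (Or.inl hδ0) (Or.inl hδ1)]
      refine le_trans (le_of_eq ?_) (H x y)
      rw [hδ, mul_mul_mul_comm, ENNReal.div_mul_cancel hα' hα'', ENNReal.div_mul_cancel hγ' hγ'']
    · exact mul_le_one' (ENNReal.rpow_le_one (bdd f α hα x) ha.le)
        (ENNReal.rpow_le_one (bdd g γ hγ y) hb.le)

/-- The **Prékopa–Leindler inequality** on `ℝ`. -/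
theorem prekopa_leindler_real {a b : ℝ} (ha : 0 < a) (hb : 0 < b) (hab : a + b = 1)
    {f g h : ℝ → ℝ≥0∞} (hf : Measurable f) (hg : Measurable g) (hh : Measurable h)
    (H : ∀ x y, f x ^ a * g y ^ b ≤ h (a * x + b * y)) :
    (∫⁻ x, f x) ^ a * (∫⁻ x, g x) ^ b ≤ ∫⁻ x, h x := by
  have trunc : ∀ u : ℝ → ℝ≥0∞, Measurable u →
      Tendsto (fun n : ℕ => ∫⁻ x, min (u x) n) atTop (𝓝 (∫⁻ x, u x)) := by
    intro u hu
    refine lintegral_tendsto_of_tendsto_of_monotone (fun n => (hu.min measurable_const).aemeasurable)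
      (Eventually.of_forall fun x m n hmn => min_le_min_left _ (by exact_mod_cast hmn))
      (Eventually.of_forall fun x => ?_)
    have := (tendsto_const_nhds (x := u x)).min ENNReal.tendsto_nat_nhds_top
    simpa using this
  rcases eq_or_ne (∫⁻ x, f x) 0 with h0 | hf0
  · simp [h0, ENNReal.zero_rpow_of_pos ha]
  rcases eq_or_ne (∫⁻ x, g x) 0 with h0 | hg0
  · simp [h0, ENNReal.zero_rpow_of_pos hb]
  have hlim := ENNReal.Tendsto.mul ((trunc f hf).ennrpow_const a)
    (Or.inl (by simp [ENNReal.rpow_eq_zero_iff, hf0, ha.not_gt]))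
    ((trunc g hg).ennrpow_const b) (Or.inl (by simp [ENNReal.rpow_eq_zero_iff, hg0, hb.not_gt]))
  refine le_of_tendsto' hlim fun n => ?_
  have fin : ∀ u : ℝ → ℝ≥0∞, ⨆ x, min (u x) (n : ℝ≥0∞) ≠ ⊤ := fun u =>
    ne_top_of_le_ne_top (ENNReal.natCast_ne_top n) (iSup_le fun x => min_le_right _ _)
  refine prekopa_leindler_real_of_bounded ha hb hab (hf.min measurable_const)
    (hg.min measurable_const) hh (fin f) (fin g) fun x y => le_trans ?_ (H x y)
  gcongr <;> exact min_le_left _ _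

theorem lintegral_fin_succ {n : ℕ} {f : (Fin (n + 1) → ℝ) → ℝ≥0∞} (hf : Measurable f) :
    ∫⁻ x, f x = ∫⁻ t : ℝ, ∫⁻ y : Fin n → ℝ, f (Fin.cons t y) := by
  have e := (volume_preserving_piFinSuccAbove (fun _ : Fin (n + 1) => ℝ) 0).symm
  rw [← e.lintegral_comp hf, Measure.volume_eq_prod, lintegral_prod _ (by fun_prop)]
  simp [MeasurableEquiv.piFinSuccAbove_symm_apply, Fin.insertNthEquiv]

theorem measurable_lintegral_cons {n : ℕ} {f : (Fin (n + 1) → ℝ) → ℝ≥0∞} (hf : Measurable f) :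
    Measurable fun t : ℝ => ∫⁻ y : Fin n → ℝ, f (Fin.cons t y) := by
  refine Measurable.lintegral_prod_right' (f := fun p : ℝ × (Fin n → ℝ) => f (Fin.cons p.1 p.2)) ?_
  refine hf.comp (measurable_pi_lambda _ fun i => ?_)
  refine Fin.cases ?_ (fun j => ?_) i <;> simp <;> fun_prop

/-- The **Prékopa–Leindler inequality** on `ℝⁿ`, by induction on `n`: the integrals of `f`, `g`, `h`
over the last `n` coordinates satisfy the hypothesis of the one-dimensional inequality. -/
theorem prekopa_leindler_pi {a b : ℝ} (ha : 0 < a) (hb : 0 < b) (hab : a + b = 1) :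
    ∀ {n : ℕ} {f g h : (Fin n → ℝ) → ℝ≥0∞}, Measurable f → Measurable g → Measurable h →
    (∀ x y, f x ^ a * g y ^ b ≤ h (a • x + b • y)) →
    (∫⁻ x, f x) ^ a * (∫⁻ x, g x) ^ b ≤ ∫⁻ x, h x
  | 0, f, g, h, _, _, _, H => by
    have hv : (volume : Measure (Fin 0 → ℝ)) univ = 1 := by simp [volume_pi]
    simp only [lintegral_unique, hv, mul_one]
    exact (H _ _).trans (le_of_eq (congrArg h (Subsingleton.elim _ _)))
  | n + 1, f, g, h, hf, hg, hh, H => by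
    rw [lintegral_fin_succ hf, lintegral_fin_succ hg, lintegral_fin_succ hh]
    refine prekopa_leindler_real ha hb hab (measurable_lintegral_cons hf)
      (measurable_lintegral_cons hg) (measurable_lintegral_cons hh) fun s t => ?_
    have mc : ∀ r : ℝ, Measurable fun y : Fin n → ℝ => (Fin.cons r y : Fin (n + 1) → ℝ) := fun r =>
      measurable_pi_lambda _ fun i => by
        refine Fin.cases ?_ (fun j => ?_) i <;> (simp; try fun_prop)
    refine prekopa_leindler_pi ha hb hab (hf.comp (mc s)) (hg.comp (mc t)) (hh.comp (mc _))
      fun x y => ?_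
    refine (H (Fin.cons s x) (Fin.cons t y)).trans (le_of_eq ?_)
    congr 1
    ext i
    refine Fin.cases ?_ (fun j => ?_) i <;> simp

/-- The **Prékopa–Leindler inequality** on Euclidean space. -/
theorem prekopa_leindler {d : ℕ} {a b : ℝ} (ha : 0 < a) (hb : 0 < b) (hab : a + b = 1)
    {f g h : EuclideanSpace ℝ (Fin d) → ℝ≥0∞} (hf : Measurable f) (hg : Measurable g)
    (hh : Measurable h) (H : ∀ x y, f x ^ a * g y ^ b ≤ h (a • x + b • y)) :
    (∫⁻ x, f x) ^ a * (∫⁻ x, g x) ^ b ≤ ∫⁻ x, h x := by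
  have e := PiLp.volume_preserving_toLp (Fin d)
  have m : Measurable (WithLp.toLp 2 : (Fin d → ℝ) → EuclideanSpace ℝ (Fin d)) := by fun_prop
  rw [← e.lintegral_comp hf, ← e.lintegral_comp hg, ← e.lintegral_comp hh]
  exact prekopa_leindler_pi ha hb hab (hf.comp m) (hg.comp m) (hh.comp m) fun x y =>
    H (WithLp.toLp 2 x) (WithLp.toLp 2 y)

/-! ### The Gaussian density and Gaussian smoothing -/

theorem gaussianDensity_pos {d : ℕ} {σ : ℝ} (hσ : 0 < σ) (x : EuclideanSpace ℝ (Fin d)) :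
    0 < gaussianDensity σ x := by
  unfold gaussianDensity
  positivity

theorem continuous_gaussianDensity {d : ℕ} (σ : ℝ) :
    Continuous (gaussianDensity σ : EuclideanSpace ℝ (Fin d) → ℝ) := by
  unfold gaussianDensity
  fun_prop

theorem gaussianDensity_le {d : ℕ} {σ : ℝ} (hσ : 0 < σ) (x : EuclideanSpace ℝ (Fin d)) :
    gaussianDensity σ x ≤ (2 * Real.pi * σ ^ 2) ^ (-(d : ℝ) / 2) := by
  unfold gaussianDensity
  refine mul_le_of_le_one_right (by positivity) (Real.exp_le_one_iff.2 ?_)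
  rw [neg_div]
  exact neg_nonpos.2 (by positivity)

theorem integral_gaussianDensity {d : ℕ} {σ : ℝ} (hσ : 0 < σ) :
    ∫ x : EuclideanSpace ℝ (Fin d), gaussianDensity σ x = 1 := by
  have h := GaussianFourier.integral_rexp_neg_mul_sq_norm (V := EuclideanSpace ℝ (Fin d))
    (b := 1 / (2 * σ ^ 2)) (by positivity)
  have e : ∀ x : EuclideanSpace ℝ (Fin d), gaussianDensity σ x =
      (2 * Real.pi * σ ^ 2) ^ (-(d : ℝ) / 2) * Real.exp (-(1 / (2 * σ ^ 2)) * ‖x‖ ^ 2) := by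
    intro x
    unfold gaussianDensity
    ring_nf
  simp_rw [e]
  rw [integral_const_mul, h, finrank_euclideanSpace_fin,
    show Real.pi / (1 / (2 * σ ^ 2)) = 2 * Real.pi * σ ^ 2 by field_simp,
    ← Real.rpow_add (by positivity)]
  simp [neg_div]

theorem integrable_gaussianDensity {d : ℕ} {σ : ℝ} (hσ : 0 < σ) :
    Integrable (gaussianDensity σ : EuclideanSpace ℝ (Fin d) → ℝ) := by
  by_contra h
  have := integral_gaussianDensity (d := d) hσ
  rw [integral_undef h] at this
  exact zero_ne_one this

theorem isProbabilityMeasure_densityMeasure_gaussianDensity {d : ℕ} {σ : ℝ} (hσ : 0 < σ) :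
    IsProbabilityMeasure (densityMeasure (gaussianDensity σ : EuclideanSpace ℝ (Fin d) → ℝ)) := by
  refine ⟨?_⟩
  rw [densityMeasure, withDensity_apply _ MeasurableSet.univ, Measure.restrict_univ,
    ← ofReal_integral_eq_lintegral_ofReal (integrable_gaussianDensity hσ)
      (Eventually.of_forall fun x => (gaussianDensity_pos hσ x).le),
    integral_gaussianDensity hσ, ENNReal.ofReal_one]

theorem charFun_densityMeasure_gaussianDensity {d : ℕ} {σ : ℝ} (hσ : 0 < σ)
    (ξ : EuclideanSpace ℝ (Fin d)) :
    charFun (densityMeasure (gaussianDensity σ)) ξ =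
      Complex.exp ((-(‖ξ‖ ^ 2 * σ ^ 2 / 2) : ℝ)) := by
  have h := GaussianFourier.integral_cexp_neg_mul_sq_norm_add (V := EuclideanSpace ℝ (Fin d))
    (b := ((1 / (2 * σ ^ 2) : ℝ) : ℂ)) (by rw [Complex.ofReal_re]; positivity) Complex.I ξ
  have m : Measurable fun x : EuclideanSpace ℝ (Fin d) => ENNReal.ofReal (gaussianDensity σ x) :=
    (continuous_gaussianDensity σ).measurable.ennreal_ofReal
  rw [charFun_apply, densityMeasure, integral_withDensity_eq_integral_toReal_smul m
    (Eventually.of_forall fun _ => ENNReal.ofReal_lt_top)]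
  have e : ∀ x : EuclideanSpace ℝ (Fin d),
      (ENNReal.ofReal (gaussianDensity σ x)).toReal • Complex.exp (inner ℝ x ξ * Complex.I) =
      (((2 * Real.pi * σ ^ 2) ^ (-(d : ℝ) / 2) : ℝ) : ℂ) *
        Complex.exp (-((1 / (2 * σ ^ 2) : ℝ) : ℂ) * ‖x‖ ^ 2 + Complex.I * (inner ℝ ξ x : ℝ)) := by
    intro x
    rw [ENNReal.toReal_ofReal (gaussianDensity_pos hσ x).le, real_inner_comm, Complex.exp_add,
      gaussianDensity, Complex.real_smul]
    push_cast
    rw [mul_comm Complex.I]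
    ring_nf
  simp_rw [e]
  rw [integral_const_mul, h, finrank_euclideanSpace_fin]
  have h2 : ((Real.pi : ℂ) / ((1 / (2 * σ ^ 2) : ℝ) : ℂ)) ^ ((d : ℂ) / 2) =
      (((2 * Real.pi * σ ^ 2) ^ ((d : ℝ) / 2) : ℝ) : ℂ) := by
    rw [Complex.ofReal_cpow (by positivity)]
    congr 1
    · push_cast
      have : (σ : ℂ) ≠ 0 := by exact_mod_cast hσ.ne'
      field_simp
    · push_cast
      rfl
  rw [h2, ← mul_assoc, ← Complex.ofReal_mul, ← Real.rpow_add (by positivity)]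
  have h3 : (-(d : ℝ) / 2 + d / 2) = 0 := by ring
  rw [h3, Real.rpow_zero, Complex.ofReal_one, one_mul, Complex.I_sq]
  congr 1
  push_cast
  have : (σ : ℂ) ≠ 0 := by exact_mod_cast hσ.ne'
  field_simp
  norm_num

theorem hasFDerivAt_gaussianDensity {d : ℕ} (σ : ℝ) (x : EuclideanSpace ℝ (Fin d)) :
    HasFDerivAt (gaussianDensity σ) (-(gaussianDensity σ x / σ ^ 2) • innerSL ℝ x) x := by
  have h1 := ((hasFDerivAt_id x).norm_sq.fun_neg.mul_const (2 * σ ^ 2)⁻¹).exp.const_mul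
    ((2 * Real.pi * σ ^ 2) ^ (-(d : ℝ) / 2))
  refine (h1.congr_of_eventuallyEq (Eventually.of_forall fun y => ?_)).congr_fderiv ?_
  · simp [gaussianDensity, div_eq_mul_inv]
  · ext y
    simp [gaussianDensity, div_eq_mul_inv]
    ring

/-- The derivative of the Gaussian density is bounded. -/
theorem norm_fderiv_gaussianDensity_le {d : ℕ} {σ : ℝ} (hσ : 0 < σ)
    (x : EuclideanSpace ℝ (Fin d)) :
    ‖-(gaussianDensity σ x / σ ^ 2) • innerSL ℝ x‖ ≤
      (2 * Real.pi * σ ^ 2) ^ (-(d : ℝ) / 2) / σ := by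
  have hg := gaussianDensity_pos hσ x
  rw [norm_smul, norm_neg, Real.norm_of_nonneg (by positivity), innerSL_apply_norm]
  -- `u ≤ 1 + u² / 2 ≤ exp (u² / 2)` at `u = ‖x‖ / σ`
  have h1 : ‖x‖ / σ * Real.exp (-‖x‖ ^ 2 / (2 * σ ^ 2)) ≤ 1 := by
    have h2 := Real.add_one_le_exp (‖x‖ ^ 2 / (2 * σ ^ 2))
    have h3 : ‖x‖ / σ ≤ ‖x‖ ^ 2 / (2 * σ ^ 2) + 1 := by
      have : ‖x‖ ^ 2 / (2 * σ ^ 2) = (‖x‖ / σ) ^ 2 / 2 := by field_simp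
      rw [this]
      nlinarith [sq_nonneg (‖x‖ / σ - 1)]
    rw [neg_div, Real.exp_neg, ← div_eq_mul_inv, div_le_one (Real.exp_pos _)]
    exact h3.trans h2
  have h4 : gaussianDensity σ x / σ ^ 2 * ‖x‖ = (2 * Real.pi * σ ^ 2) ^ (-(d : ℝ) / 2) / σ *
      (‖x‖ / σ * Real.exp (-‖x‖ ^ 2 / (2 * σ ^ 2))) := by
    unfold gaussianDensity
    field_simp
  rw [h4]
  exact mul_le_of_le_one_right (by positivity) h1

/-- The density of `m Y + s Z` for independent `Y ∼ μ` and `Z` standard Gaussian. -/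
noncomputable def smoothedDensity {d : ℕ} (m s : ℝ) (μ : Measure (EuclideanSpace ℝ (Fin d)))
    (x : EuclideanSpace ℝ (Fin d)) : ℝ :=
  ∫ y, gaussianDensity s (x - m • y) ∂μ

section Smoothing

variable {d : ℕ} {m s : ℝ} {μ : Measure (EuclideanSpace ℝ (Fin d))}

theorem integrable_gaussianDensity_sub_smul [IsFiniteMeasure μ] (hs : 0 < s)
    (x : EuclideanSpace ℝ (Fin d)) : Integrable (fun y => gaussianDensity s (x - m • y)) μ := by
  refine Integrable.of_bound (C := (2 * Real.pi * s ^ 2) ^ (-(d : ℝ) / 2)) ?_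
    (Eventually.of_forall fun y => ?_)
  · exact ((continuous_gaussianDensity s).comp (by fun_prop)).aestronglyMeasurable
  · rw [Real.norm_of_nonneg (gaussianDensity_pos hs _).le]
    exact gaussianDensity_le hs _

theorem smoothedDensity_pos [IsProbabilityMeasure μ] (hs : 0 < s)
    (x : EuclideanSpace ℝ (Fin d)) : 0 < smoothedDensity m s μ x := by
  refine (integral_pos_iff_support_of_nonneg (fun y => (gaussianDensity_pos hs _).le)
    (integrable_gaussianDensity_sub_smul hs x)).2 ?_
  have : Function.support (fun y => gaussianDensity s (x - m • y)) = univ :=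
    eq_univ_of_forall fun y => (gaussianDensity_pos hs _).ne'
  rw [this]
  simp

theorem differentiable_smoothedDensity [IsProbabilityMeasure μ] (hs : 0 < s) :
    Differentiable ℝ (smoothedDensity m s μ) := by
  intro x
  refine (hasFDerivAt_integral_of_dominated_of_fderiv_le (𝕜 := ℝ) (s := univ)
    (F := fun x y => gaussianDensity s (x - m • y))
    (F' := fun x y => -(gaussianDensity s (x - m • y) / s ^ 2) • innerSL ℝ (x - m • y))
    (bound := fun _ => (2 * Real.pi * s ^ 2) ^ (-(d : ℝ) / 2) / s)
    univ_mem ?_ (integrable_gaussianDensity_sub_smul hs x) ?_ ?_ (integrable_const _)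
    ?_).differentiableAt
  · exact Eventually.of_forall fun z => (integrable_gaussianDensity_sub_smul hs z).1
  · have hc : Continuous fun y : EuclideanSpace ℝ (Fin d) => gaussianDensity s (x - m • y) :=
      (continuous_gaussianDensity s).comp (by fun_prop)
    refine Continuous.aestronglyMeasurable ?_
    exact (hc.div_const _).neg.smul ((innerSL ℝ).continuous.comp (by fun_prop))
  · exact Eventually.of_forall fun y z _ => norm_fderiv_gaussianDensity_le hs _
  · refine Eventually.of_forall fun y z _ => ?_
    exact (hasFDerivAt_gaussianDensity s (z - m • y)).comp z ((hasFDerivAt_id z).sub_const _)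

/-- Smoothing is convolution with a Gaussian measure. -/
theorem densityMeasure_smoothedDensity [IsProbabilityMeasure μ] (hs : 0 < s) :
    densityMeasure (smoothedDensity m s μ) =
      (μ.map fun y => m • y) ∗ densityMeasure (gaussianDensity s) := by
  have : IsProbabilityMeasure (densityMeasure (gaussianDensity s : EuclideanSpace ℝ (Fin d) → ℝ)) :=
    isProbabilityMeasure_densityMeasure_gaussianDensity hs
  have hg : Measurable fun x : EuclideanSpace ℝ (Fin d) => ENNReal.ofReal (gaussianDensity s x) :=
    (continuous_gaussianDensity s).measurable.ennreal_ofReal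
  refine Measure.ext_of_lintegral _ fun f hf => ?_
  rw [Measure.lintegral_conv hf, lintegral_map (by fun_prop) (by fun_prop), densityMeasure,
    lintegral_withDensity_eq_lintegral_mul _
      (differentiable_smoothedDensity hs).continuous.measurable.ennreal_ofReal hf]
  have e1 : ∀ x, ENNReal.ofReal (smoothedDensity m s μ x) * f x =
      ∫⁻ y, ENNReal.ofReal (gaussianDensity s (x - m • y)) * f x ∂μ := fun x => by
    have hg' : Measurable fun y => ENNReal.ofReal (gaussianDensity s (x - m • y)) :=
      hg.comp (by fun_prop : Measurable fun y : EuclideanSpace ℝ (Fin d) => x - m • y)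
    rw [lintegral_mul_const _ hg', smoothedDensity,
      ofReal_integral_eq_lintegral_ofReal (integrable_gaussianDensity_sub_smul hs x)
        (Eventually.of_forall fun y => (gaussianDensity_pos hs _).le)]
  simp_rw [Pi.mul_apply, e1]
  rw [lintegral_lintegral_swap]
  · refine lintegral_congr fun y => ?_
    rw [densityMeasure, lintegral_withDensity_eq_lintegral_mul _ hg (by fun_prop),
      ← lintegral_add_right_eq_self _ (m • y)]
    refine lintegral_congr fun x => ?_
    simp [add_comm]
  · refine Measurable.aemeasurable ?_
    exact (hg.comp (by fun_prop : Measurable fun p : EuclideanSpace ℝ (Fin d) ×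
      EuclideanSpace ℝ (Fin d) => p.1 - m • p.2)).mul (hf.comp measurable_fst)

theorem isProbabilityMeasure_densityMeasure_smoothedDensity [IsProbabilityMeasure μ] (hs : 0 < s) :
    IsProbabilityMeasure (densityMeasure (smoothedDensity m s μ)) := by
  have := isProbabilityMeasure_densityMeasure_gaussianDensity (d := d) hs
  have : IsProbabilityMeasure (μ.map fun y => m • y) :=
    Measure.isProbabilityMeasure_map (by fun_prop)
  rw [densityMeasure_smoothedDensity hs]
  infer_instance

theorem charFun_densityMeasure_smoothedDensity [IsProbabilityMeasure μ] (hs : 0 < s)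
    (ξ : EuclideanSpace ℝ (Fin d)) :
    charFun (densityMeasure (smoothedDensity m s μ)) ξ =
      charFun μ (m • ξ) * Complex.exp ((-(‖ξ‖ ^ 2 * s ^ 2 / 2) : ℝ)) := by
  have := isProbabilityMeasure_densityMeasure_gaussianDensity (d := d) hs
  rw [densityMeasure_smoothedDensity hs, charFun_conv, charFun_map_smul,
    charFun_densityMeasure_gaussianDensity hs]

end Smoothing

/-! ### Strong log-concavity -/

theorem norm_sq_combo {E : Type*} [NormedAddCommGroup E] [InnerProductSpace ℝ E] {a b : ℝ}
    (hab : a + b = 1) (u w : E) :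
    ‖a • u + b • w‖ ^ 2 = a * ‖u‖ ^ 2 + b * ‖w‖ ^ 2 - a * b * ‖u - w‖ ^ 2 := by
  obtain rfl := eq_sub_of_add_eq hab
  rw [norm_add_sq_real, norm_sub_sq_real, norm_smul, norm_smul, real_inner_smul_left,
    inner_smul_right, mul_pow, mul_pow, Real.norm_eq_abs, Real.norm_eq_abs, sq_abs, sq_abs]
  ring

/-- The quadratic form `‖ξ - m η‖² / s² + C ‖η‖²` dominates its minimum over `η`. -/
theorem mul_norm_sq_le_of_smul {E : Type*} [NormedAddCommGroup E] [NormedSpace ℝ E]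
    {C m s : ℝ} (hC : 0 < C) (hs : 0 < s) (ξ η : E) :
    1 / (m ^ 2 / C + s ^ 2) * ‖ξ‖ ^ 2 ≤ ‖ξ - m • η‖ ^ 2 / s ^ 2 + C * ‖η‖ ^ 2 := by
  have h1 : ‖ξ‖ ≤ ‖ξ - m • η‖ + |m| * ‖η‖ := by
    calc ‖ξ‖ = ‖(ξ - m • η) + m • η‖ := by rw [sub_add_cancel]
      _ ≤ _ := (norm_add_le _ _).trans (by rw [norm_smul, Real.norm_eq_abs])
  set u := ‖ξ - m • η‖
  set w := ‖η‖
  have hu : 0 ≤ u := norm_nonneg _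
  have hw : 0 ≤ w := norm_nonneg _
  have h2 : ‖ξ‖ ^ 2 ≤ (u + |m| * w) ^ 2 := pow_le_pow_left₀ (norm_nonneg _) h1 2
  rw [one_div, inv_mul_le_iff₀ (by positivity)]
  refine h2.trans ?_
  have h3 : (m ^ 2 / C + s ^ 2) * (u ^ 2 / s ^ 2 + C * w ^ 2) - (u + |m| * w) ^ 2 =
      (|m| * u - C * s ^ 2 * w) ^ 2 / (C * s ^ 2) := by
    rw [← sq_abs m]
    field_simp
    ring
  have h4 : 0 ≤ (|m| * u - C * s ^ 2 * w) ^ 2 / (C * s ^ 2) := by positivity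
  linarith

section Concavity

variable {d : ℕ} {C m s : ℝ} {p₀ : EuclideanSpace ℝ (Fin d) → ℝ}

theorem log_gaussianDensity {σ : ℝ} (hσ : 0 < σ) (x : EuclideanSpace ℝ (Fin d)) :
    Real.log (gaussianDensity σ x) =
      Real.log ((2 * Real.pi * σ ^ 2) ^ (-(d : ℝ) / 2)) - ‖x‖ ^ 2 / (2 * σ ^ 2) := by
  rw [gaussianDensity, Real.log_mul (by positivity) (Real.exp_pos _).ne', Real.log_exp]
  ring

/-- Joint log-concavity in `(x, y)` of `p₀ y * exp (-‖x - m y‖² / (2 s²)) * exp (K ‖x‖² / 2)`, where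
`K = 1 / (m² / C + s²)`. -/
theorem rpow_mul_rpow_le_of_isStronglyLogConcave (hC : 0 < C) (hs : 0 < s)
    (hp : IsStronglyLogConcave C p₀) {a b : ℝ} (ha : 0 < a) (hb : 0 < b) (hab : a + b = 1)
    (x₁ x₂ y₁ y₂ : EuclideanSpace ℝ (Fin d)) :
    (p₀ y₁ * gaussianDensity s (x₁ - m • y₁) *
        Real.exp (1 / (m ^ 2 / C + s ^ 2) / 2 * ‖x₁‖ ^ 2)) ^ a *
      (p₀ y₂ * gaussianDensity s (x₂ - m • y₂) *
        Real.exp (1 / (m ^ 2 / C + s ^ 2) / 2 * ‖x₂‖ ^ 2)) ^ b ≤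
    p₀ (a • y₁ + b • y₂) * gaussianDensity s ((a • x₁ + b • x₂) - m • (a • y₁ + b • y₂)) *
        Real.exp (1 / (m ^ 2 / C + s ^ 2) / 2 * ‖a • x₁ + b • x₂‖ ^ 2) := by
  have hg := gaussianDensity_pos (d := d) hs
  have nn : 0 ≤ p₀ (a • y₁ + b • y₂) *
      gaussianDensity s ((a • x₁ + b • x₂) - m • (a • y₁ + b • y₂)) *
        Real.exp (1 / (m ^ 2 / C + s ^ 2) / 2 * ‖a • x₁ + b • x₂‖ ^ 2) :=
    mul_nonneg (mul_nonneg (hp.1 _) (hg _).le) (Real.exp_pos _).le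
  rcases (hp.1 y₁).eq_or_lt with h1 | h1
  · simpa [← h1, Real.zero_rpow ha.ne'] using nn
  rcases (hp.1 y₂).eq_or_lt with h2 | h2
  · simpa [← h2, Real.zero_rpow hb.ne'] using nn
  have h3 : 0 < p₀ (a • y₁ + b • y₂) := hp.2.1 h1 h2 ha.le hb.le hab
  have hL := hp.2.2 h1 h2 ha.le hb.le hab
  have f1 : 0 < p₀ y₁ * gaussianDensity s (x₁ - m • y₁) *
      Real.exp (1 / (m ^ 2 / C + s ^ 2) / 2 * ‖x₁‖ ^ 2) :=
    mul_pos (mul_pos h1 (hg _)) (Real.exp_pos _)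
  have f2 : 0 < p₀ y₂ * gaussianDensity s (x₂ - m • y₂) *
      Real.exp (1 / (m ^ 2 / C + s ^ 2) / 2 * ‖x₂‖ ^ 2) :=
    mul_pos (mul_pos h2 (hg _)) (Real.exp_pos _)
  have f3 := mul_pos (mul_pos h3 (hg ((a • x₁ + b • x₂) - m • (a • y₁ + b • y₂))))
    (Real.exp_pos (1 / (m ^ 2 / C + s ^ 2) / 2 * ‖a • x₁ + b • x₂‖ ^ 2))
  rw [← Real.log_le_log_iff (mul_pos (Real.rpow_pos_of_pos f1 a) (Real.rpow_pos_of_pos f2 b)) f3,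
    Real.log_mul (Real.rpow_pos_of_pos f1 a).ne' (Real.rpow_pos_of_pos f2 b).ne',
    Real.log_rpow f1, Real.log_rpow f2]
  have lg : ∀ (y v : EuclideanSpace ℝ (Fin d)) (r : ℝ), 0 < p₀ y →
      Real.log (p₀ y * gaussianDensity s v * Real.exp r) = Real.log (p₀ y) +
        (Real.log ((2 * Real.pi * s ^ 2) ^ (-(d : ℝ) / 2)) - ‖v‖ ^ 2 / (2 * s ^ 2)) + r := by
    intro y v r hy
    rw [Real.log_mul (mul_pos hy (hg v)).ne' (Real.exp_pos r).ne', Real.log_exp,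
      Real.log_mul hy.ne' (hg v).ne', log_gaussianDensity hs]
  rw [lg _ _ _ h1, lg _ _ _ h2, lg _ _ _ h3]
  have e1 : (a • x₁ + b • x₂) - m • (a • y₁ + b • y₂) =
      a • (x₁ - m • y₁) + b • (x₂ - m • y₂) := by module
  have e2 : (x₁ - m • y₁) - (x₂ - m • y₂) = (x₁ - x₂) - m • (y₁ - y₂) := by module
  rw [e1, norm_sq_combo hab, norm_sq_combo hab, e2]
  have key := mul_norm_sq_le_of_smul (m := m) hC hs (x₁ - x₂) (y₁ - y₂)
  simp only [smul_eq_mul] at hL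
  set K := 1 / (m ^ 2 / C + s ^ 2)
  set c := Real.log ((2 * Real.pi * s ^ 2) ^ (-(d : ℝ) / 2))
  have key' := mul_le_mul_of_nonneg_left key (by positivity : 0 ≤ a * b / 2)
  have e3 : ∀ r : ℝ, r / (2 * s ^ 2) = r / s ^ 2 / 2 := fun r => by field_simp
  have hc : a * c + b * c = c := by rw [← add_mul, hab, one_mul]
  simp only [e3, sub_div, add_div, mul_div_assoc]
  ring_nf at key' hL hc ⊢
  linarith

theorem integral_densityMeasure (hp₀ : Measurable p₀) (h0 : ∀ x, 0 ≤ p₀ x)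
    (f : EuclideanSpace ℝ (Fin d) → ℝ) :
    ∫ x, f x ∂(densityMeasure p₀) = ∫ x, p₀ x * f x := by
  rw [densityMeasure, integral_withDensity_eq_integral_toReal_smul hp₀.ennreal_ofReal
    (Eventually.of_forall fun _ => ENNReal.ofReal_lt_top)]
  exact integral_congr_ae (Eventually.of_forall fun x => by
    simp [ENNReal.toReal_ofReal (h0 x)])

/-- Smoothing a `C`-strongly log-concave density preserves strong log-concavity, with the constant
of the corresponding Gaussian computation: by the Prékopa–Leindler inequality, a marginal of a
jointly log-concave function is log-concave. -/
theorem strongConcaveOn_log_smoothedDensity (hC : 0 < C) (hs : 0 < s)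
    (hp₀ : Measurable p₀) (hp : IsStronglyLogConcave C p₀)
    [IsProbabilityMeasure (densityMeasure p₀)] :
    StrongConcaveOn univ (1 / (m ^ 2 / C + s ^ 2))
      (fun x => Real.log (smoothedDensity m s (densityMeasure p₀) x)) := by
  rw [strongConcaveOn_iff_convex, concaveOn_iff_forall_pos]
  refine ⟨convex_univ, fun x₁ _ x₂ _ a b ha hb hab => ?_⟩
  set K := 1 / (m ^ 2 / C + s ^ 2) with hK
  set q := smoothedDensity m s (densityMeasure p₀) with hq
  have hqpos : ∀ x, 0 < q x := fun x => smoothedDensity_pos hs x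
  set F : EuclideanSpace ℝ (Fin d) → EuclideanSpace ℝ (Fin d) → ℝ := fun x y =>
    p₀ y * gaussianDensity s (x - m • y) * Real.exp (K / 2 * ‖x‖ ^ 2) with hF
  have hg : ∀ x, Measurable fun y : EuclideanSpace ℝ (Fin d) => gaussianDensity s (x - m • y) :=
    fun x => ((continuous_gaussianDensity s).comp (by fun_prop)).measurable
  have hFm : ∀ x, Measurable fun y => ENNReal.ofReal (F x y) := fun x =>
    ((hp₀.mul (hg x)).mul_const _).ennreal_ofReal
  have hF0 : ∀ x y, 0 ≤ F x y := fun x y =>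
    mul_nonneg (mul_nonneg (hp.1 _) (gaussianDensity_pos hs _).le) (Real.exp_pos _).le
  have hFi : ∀ x, ∫⁻ y, ENNReal.ofReal (F x y) =
      ENNReal.ofReal (q x * Real.exp (K / 2 * ‖x‖ ^ 2)) := by
    intro x
    have hI : ∫ y, F x y = q x * Real.exp (K / 2 * ‖x‖ ^ 2) := by
      rw [hF, integral_mul_const, hq, smoothedDensity, integral_densityMeasure hp₀ hp.1]
    have hint : Integrable (F x) := by
      by_contra h
      rw [integral_undef h] at hI
      exact (mul_pos (hqpos x) (Real.exp_pos _)).ne hI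
    rw [← hI, ofReal_integral_eq_lintegral_ofReal hint (Eventually.of_forall (hF0 x))]
  have hPL := prekopa_leindler ha hb hab (hFm x₁) (hFm x₂) (hFm (a • x₁ + b • x₂)) fun y₁ y₂ => by
    rw [ENNReal.ofReal_rpow_of_nonneg (hF0 _ _) ha.le, ENNReal.ofReal_rpow_of_nonneg (hF0 _ _) hb.le,
      ← ENNReal.ofReal_mul (Real.rpow_nonneg (hF0 _ _) _)]
    exact ENNReal.ofReal_le_ofReal
      (rpow_mul_rpow_le_of_isStronglyLogConcave hC hs hp ha hb hab x₁ x₂ y₁ y₂)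
  have hQ : ∀ x, 0 < q x * Real.exp (K / 2 * ‖x‖ ^ 2) := fun x =>
    mul_pos (hqpos x) (Real.exp_pos _)
  rw [hFi, hFi, hFi, ENNReal.ofReal_rpow_of_pos (hQ _), ENNReal.ofReal_rpow_of_pos (hQ _),
    ← ENNReal.ofReal_mul (Real.rpow_nonneg (hQ _).le _), ENNReal.ofReal_le_ofReal_iff (hQ _).le,
    ← Real.log_le_log_iff (mul_pos (Real.rpow_pos_of_pos (hQ _) _) (Real.rpow_pos_of_pos (hQ _) _))
      (hQ _),
    Real.log_mul (Real.rpow_pos_of_pos (hQ _) a).ne' (Real.rpow_pos_of_pos (hQ _) b).ne',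
    Real.log_rpow (hQ _), Real.log_rpow (hQ _)] at hPL
  have lg : ∀ x, Real.log (q x * Real.exp (K / 2 * ‖x‖ ^ 2)) =
      Real.log (q x) + K / 2 * ‖x‖ ^ 2 := fun x => by
    rw [Real.log_mul (hqpos x).ne' (Real.exp_pos _).ne', Real.log_exp]
  simpa only [lg, smul_eq_mul] using hPL

theorem log_renormalized {σ : ℝ} (hσ : 0 < σ) {p : EuclideanSpace ℝ (Fin d) → ℝ}
    {x : EuclideanSpace ℝ (Fin d)} (hp : 0 < p x) :
    Real.log (renormalized σ p x) = Real.log (p x) + 1 / σ ^ 2 / 2 * ‖x‖ ^ 2 -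
      Real.log ((2 * Real.pi * σ ^ 2) ^ (-(d : ℝ) / 2)) := by
  rw [renormalized, Real.log_div hp.ne' (gaussianDensity_pos hσ x).ne', log_gaussianDensity hσ]
  field_simp
  ring

/-- Dividing by the density of `𝒩(0, σ² I)` lowers the constant of strong log-concavity by exactly
`1 / σ²`. -/
theorem strongConcaveOn_log_renormalized {σ K : ℝ} (hσ : 0 < σ)
    {p : EuclideanSpace ℝ (Fin d) → ℝ}
    (h : StrongConcaveOn {x | 0 < p x} K fun x => Real.log (p x)) :
    StrongConcaveOn {x | 0 < p x} (K - 1 / σ ^ 2) fun x => Real.log (renormalized σ p x) := by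
  rw [strongConcaveOn_iff_convex] at h ⊢
  refine (h.add_const (-Real.log ((2 * Real.pi * σ ^ 2) ^ (-(d : ℝ) / 2)))).congr ?_
  intro x hx
  simp only [Pi.add_apply]
  rw [log_renormalized hσ hx]
  ring

end Concavity

/-- Along the segment from `x` to `y`, the derivative of a concave function decreases; applied to
`f + C / 2 ‖·‖²`, this is strong monotonicity of `-∇f`. -/
theorem StrongConcaveOn.mul_norm_sq_le_inner_gradient {E : Type*} [NormedAddCommGroup E]
    [InnerProductSpace ℝ E] [CompleteSpace E] {C : ℝ} {f : E → ℝ}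
    (hf : StrongConcaveOn univ C f) (hd : Differentiable ℝ f) (x y : E) :
    C * ‖x - y‖ ^ 2 ≤ inner ℝ (gradient f y - gradient f x) (x - y) := by
  rw [strongConcaveOn_iff_convex] at hf
  set F : E → ℝ := fun z => f z + C / 2 * ‖z‖ ^ 2 with hF
  have hl : ConcaveOn ℝ univ (F ∘ AffineMap.lineMap x y) := hf.comp_affineMap _
  have hder : ∀ t : ℝ, HasDerivAt (F ∘ AffineMap.lineMap x y)
      (inner ℝ (gradient f (AffineMap.lineMap x y t)) (y - x) +
        C / 2 * (2 * inner ℝ (AffineMap.lineMap x y t) (y - x))) t := by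
    intro t
    have h1 : HasDerivAt (AffineMap.lineMap x y : ℝ → E) (y - x) t := AffineMap.hasDerivAt_lineMap
    have h2 := (hd (AffineMap.lineMap x y t)).hasGradientAt.hasFDerivAt.comp_hasDerivAt t h1
    exact h2.add (h1.norm_sq.const_mul (C / 2))
  have hanti := hl.antitoneOn_deriv (fun t _ => (hder t).differentiableAt)
    (mem_univ (0 : ℝ)) (mem_univ 1) zero_le_one
  rw [(hder 0).deriv, (hder 1).deriv, AffineMap.lineMap_apply_zero,
    AffineMap.lineMap_apply_one] at hanti
  have e1 : inner ℝ y (y - x) - inner ℝ x (y - x) = ‖x - y‖ ^ 2 := by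
    rw [← inner_sub_left, real_inner_self_eq_norm_sq, norm_sub_rev]
  have e2 : inner ℝ (gradient f y - gradient f x) (x - y) =
      inner ℝ (gradient f x) (y - x) - inner ℝ (gradient f y) (y - x) := by
    rw [← neg_sub y x, inner_neg_right, inner_sub_left]
    ring
  rw [e2, ← e1]
  linarith

/-! ### Sums over partitions -/

/-- If `G` is continuous and vanishes on the diagonal, then the sum over the intervals `[x, y]` of
the uniform partition of `[0, t]` of the integrals `∫ₓʸ G (x, y, s) ds` tends to `0` as the mesh
does. -/
theorem tendsto_sum_integral_of_diag_zero {E : Type*} [NormedAddCommGroup E] [NormedSpace ℝ E]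
    {t : ℝ} (ht : 0 ≤ t) {G : ℝ × ℝ × ℝ → E}
    (hG : ContinuousOn G (Icc 0 t ×ˢ Icc 0 t ×ˢ Icc 0 t))
    (h0 : ∀ s ∈ Icc 0 t, G (s, s, s) = 0) :
    Tendsto (fun N : ℕ => ∑ k ∈ Finset.range N, ∫ s in (t * k / N)..(t * (k + 1) / N),
      G (t * k / N, t * (k + 1) / N, s)) atTop (𝓝 0) := by
  have hu := (isCompact_Icc.prod (isCompact_Icc.prod isCompact_Icc)).uniformContinuousOn_of_continuous
    hG
  rw [Metric.uniformContinuousOn_iff] at hu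
  rw [Metric.tendsto_atTop]
  intro ε hε
  obtain ⟨δ, hδ, hGδ⟩ := hu (ε / (t + 1)) (by positivity)
  obtain ⟨N₀, hN₀⟩ := exists_nat_gt (t / δ)
  refine ⟨N₀ + 1, fun N hN => ?_⟩
  have hNpos : (0 : ℝ) < N := by exact_mod_cast (by omega : 0 < N)
  have hmesh : t / N < δ := by
    rw [div_lt_iff₀ hNpos]
    rw [div_lt_iff₀ hδ] at hN₀
    have : (N₀ : ℝ) ≤ N := by exact_mod_cast (by omega : N₀ ≤ N)
    nlinarith
  have bound : ∀ k ∈ Finset.range N, ‖∫ s in (t * k / N)..(t * (k + 1) / N),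
      G (t * k / N, t * (k + 1) / N, s)‖ ≤ ε / (t + 1) * (t / N) := by
    intro k hk
    have hkN : ((k : ℝ) + 1) ≤ N := by exact_mod_cast Finset.mem_range.1 hk
    have hstep : t * (k + 1) / N - t * k / N = t / N := by ring
    have htN : 0 ≤ t / N := by positivity
    have hx0 : 0 ≤ t * k / N := by positivity
    have hyt : t * (k + 1) / N ≤ t := by
      rw [div_le_iff₀ hNpos]
      exact mul_le_mul_of_nonneg_left hkN ht
    refine (intervalIntegral.norm_integral_le_of_norm_le_const (C := ε / (t + 1)) ?_).trans ?_
    · intro s hs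
      rw [uIoc_of_le (by linarith)] at hs
      have hs1 := hs.1
      have hs2 := hs.2
      have hsm : s ∈ Icc 0 t := ⟨by linarith, by linarith⟩
      have := hGδ (t * k / N, t * (k + 1) / N, s)
        ⟨⟨hx0, by linarith⟩, ⟨by linarith, hyt⟩, hsm⟩ (s, s, s) ⟨hsm, hsm, hsm⟩ (by
          simp only [Prod.dist_eq, Real.dist_eq, max_lt_iff, abs_lt]
          refine ⟨⟨?_, ?_⟩, ⟨?_, ?_⟩, ?_, ?_⟩ <;> linarith)
      rw [h0 s hsm, dist_zero_right] at this
      exact this.le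
    · rw [hstep, abs_of_nonneg htN]
  rw [dist_zero_right]
  calc _ ≤ ∑ k ∈ Finset.range N, ε / (t + 1) * (t / N) := norm_sum_le_of_le _ bound
    _ = ε * (t / (t + 1)) := by
        rw [Finset.sum_const, Finset.card_range, nsmul_eq_mul]
        field_simp
    _ < ε * 1 := by
        refine mul_lt_mul_of_pos_left ?_ hε
        rw [div_lt_one (by positivity)]
        linarith
    _ = ε := mul_one ε

theorem partition_mem_Icc {t : ℝ} (ht : 0 ≤ t) {k N : ℕ} (hk : k ≤ N) :
    t * k / N ∈ Icc 0 t := by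
  rcases Nat.eq_zero_or_pos N with rfl | hN
  · simpa using ht
  · have hN' : (0 : ℝ) < N := by exact_mod_cast hN
    have : (k : ℝ) ≤ N := by exact_mod_cast hk
    refine ⟨by positivity, ?_⟩
    rw [div_le_iff₀ hN']
    exact mul_le_mul_of_nonneg_left this ht

theorem sum_integral_partition {E : Type*} [NormedAddCommGroup E] [NormedSpace ℝ E]
    {t : ℝ} (ht : 0 ≤ t) {f : ℝ → E} (hf : ContinuousOn f (Icc 0 t)) {N : ℕ} (hN : N ≠ 0) :
    ∑ k ∈ Finset.range N, ∫ s in (t * k / N)..(t * (k + 1) / N), f s = ∫ s in (0 : ℝ)..t, f s := by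
  have hN' : (N : ℝ) ≠ 0 := by exact_mod_cast hN
  have := intervalIntegral.sum_integral_adjacent_intervals (f := f) (μ := volume)
    (a := fun k : ℕ => t * k / N) (n := N) fun k hk => by
      refine (hf.mono ?_).intervalIntegrable
      exact (convex_Icc 0 t).ordConnected.uIcc_subset (partition_mem_Icc ht hk.le)
        (partition_mem_Icc ht (by omega))
  simpa [mul_div_assoc, div_self hN'] using this

/-- Left-point Riemann sums of a continuous function converge to its integral. -/
theorem tendsto_riemannSum {t : ℝ} (ht : 0 ≤ t) {f : ℝ → ℝ} (hf : ContinuousOn f (Icc 0 t)) :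
    Tendsto (fun N : ℕ => ∑ k ∈ Finset.range N, f (t * k / N) * (t / N)) atTop
      (𝓝 (∫ s in (0 : ℝ)..t, f s)) := by
  have h := tendsto_sum_integral_of_diag_zero ht (G := fun p => f p.1 - f p.2.2)
    ((hf.comp continuousOn_fst fun p hp => hp.1).sub
      (hf.comp (continuousOn_snd.comp continuousOn_snd fun p hp => hp.2) fun p hp => hp.2.2))
    (fun s _ => sub_self _)
  have h' := h.add_const (∫ s in (0 : ℝ)..t, f s)
  rw [zero_add] at h'
  refine h'.congr' ?_
  filter_upwards [eventually_ne_atTop 0] with N hN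
  rw [← sum_integral_partition ht hf hN, ← Finset.sum_add_distrib]
  refine Finset.sum_congr rfl fun k hk => ?_
  have hi : IntervalIntegrable f volume (t * k / N) (t * (k + 1) / N) := by
    refine (hf.mono ?_).intervalIntegrable
    have := partition_mem_Icc ht (Finset.mem_range.1 hk : k + 1 ≤ N)
    push_cast at this
    exact (convex_Icc 0 t).ordConnected.uIcc_subset
      (partition_mem_Icc ht (Finset.mem_range.1 hk).le) this
  rw [intervalIntegral.integral_sub intervalIntegrable_const hi, sub_add_cancel,
    intervalIntegral.integral_const, smul_eq_mul, mul_comm]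
  ring

/-- Grouping a sum of `N * n` terms into `N` blocks of length `n`, with a weight on each block. -/
theorem sum_smul_block_sub {V : Type*} [AddCommGroup V] [Module ℝ V] (w : ℕ → ℝ) (a : ℕ → V)
    (N : ℕ) {n : ℕ} (hn : 0 < n) :
    ∑ k ∈ Finset.range N, w k •
      (∑ j ∈ Finset.range ((k + 1) * n), a j - ∑ j ∈ Finset.range (k * n), a j) =
    ∑ j ∈ Finset.range (N * n), w (j / n) • a j := by
  induction N with
  | zero => simp
  | succ N ih =>
    rw [Finset.sum_range_succ, ih, add_one_mul, Finset.sum_range_add, Finset.sum_range_add,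
      add_sub_cancel_left, Finset.smul_sum]
    congr 1
    refine Finset.sum_congr rfl fun i hi => ?_
    have : (N * n + i) / n = N := by
      rw [mul_comm, Nat.mul_add_div hn, Nat.div_eq_of_lt (Finset.mem_range.1 hi), add_zero]
    rw [this]

/-! ### Convergence of random variables and characteristic functions -/

/-- Finitely many sequences that converge in measure converge almost everywhere along a common
subsequence. -/
theorem exists_seq_tendsto_ae_of_forall_lt {Ω E : Type*} [MeasurableSpace Ω] {P : Measure Ω}
    [PseudoEMetricSpace E] {f : ℕ → ℕ → Ω → E} {g : ℕ → Ω → E} (N : ℕ)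
    (h : ∀ k < N, TendstoInMeasure P (f k) atTop (g k)) :
    ∃ ns : ℕ → ℕ, StrictMono ns ∧
      ∀ k < N, ∀ᵐ ω ∂P, Tendsto (fun i => f k (ns i) ω) atTop (𝓝 (g k ω)) := by
  induction N with
  | zero => exact ⟨id, strictMono_id, by simp⟩
  | succ N ih =>
    obtain ⟨ns, hns, hlim⟩ := ih fun k hk => h k (by omega)
    obtain ⟨ms, hms, hlim'⟩ :=
      ((h N (by omega)).comp hns.tendsto_atTop).exists_seq_tendsto_ae
    refine ⟨ns ∘ ms, hns.comp hms, fun k hk => ?_⟩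
    rcases Nat.lt_succ_iff_lt_or_eq.1 hk with hk | rfl
    · filter_upwards [hlim k hk] with ω hω using hω.comp hms.tendsto_atTop
    · exact hlim'

theorem tendsto_charFun_map_of_tendsto_ae {Ω E : Type*} [MeasurableSpace Ω] {P : Measure Ω}
    [IsFiniteMeasure P] [NormedAddCommGroup E] [InnerProductSpace ℝ E] [MeasurableSpace E]
    [BorelSpace E] [SecondCountableTopology E] {Y : ℕ → Ω → E} {Z : Ω → E}
    (hY : ∀ n, AEMeasurable (Y n) P)
    (h : ∀ᵐ ω ∂P, Tendsto (fun n => Y n ω) atTop (𝓝 (Z ω))) (ξ : E) :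
    Tendsto (fun n => charFun (P.map (Y n)) ξ) atTop (𝓝 (charFun (P.map Z) ξ)) := by
  have hZ := aemeasurable_of_tendsto_metrizable_ae atTop hY h
  have hc : Continuous fun x : E => Complex.exp (inner ℝ x ξ * Complex.I) := by fun_prop
  have e : ∀ W : Ω → E, AEMeasurable W P → charFun (P.map W) ξ =
      ∫ ω, Complex.exp (inner ℝ (W ω) ξ * Complex.I) ∂P := fun W hW => by
    rw [charFun_apply, integral_map hW hc.aestronglyMeasurable]
  rw [e Z hZ]
  simp_rw [fun n => e (Y n) (hY n)]
  refine tendsto_integral_of_dominated_convergence (fun _ => 1)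
    (fun n => (hc.measurable.comp_aemeasurable (hY n)).aestronglyMeasurable) (integrable_const 1)
    (fun n => Eventually.of_forall fun ω => ?_) ?_
  · rw [Complex.norm_exp_ofReal_mul_I]
  · filter_upwards [h] with ω hω using (hc.tendsto _).comp hω

/-! ### Linear functionals of Brownian motion -/

section Brownian

variable {Ω : Type*} [MeasurableSpace Ω] {P : Measure Ω} {d : ℕ}
  {B : ℝ≥0 → Ω → EuclideanSpace ℝ (Fin d)}

theorem charFun_map_sum_increments_real {W : ℝ≥0 → Ω → ℝ} (hW : IsPreBrownianReal W P)
    {τ : ℕ → ℝ≥0} (hτ : Monotone τ) (c : ℕ → ℝ) (L : ℕ) (u : ℝ) :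
    charFun (P.map fun ω => ∑ j ∈ Finset.range L, c j * (W (τ (j + 1)) ω - W (τ j) ω)) u =
      Complex.exp ((-(u ^ 2 * (∑ j ∈ Finset.range L, c j ^ 2 * (τ (j + 1) - τ j)) / 2) : ℝ)) := by
  have hm : ∀ j, AEMeasurable (fun ω => W (τ (j + 1)) ω - W (τ j) ω) P := fun j =>
    (hW.aemeasurable _).sub (hW.aemeasurable _)
  have hind := (hW.hasIndepIncrements.nat hτ).comp (fun j x => c j * x) fun j => by fun_prop
  have hind' := hind.precomp (Subtype.val_injective (p := fun j => j ∈ Finset.range L))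
  have h := iIndepFun.charFun_map_fun_finsetSum_eq_prod (P := P) (s := Finset.range L)
    (X := fun j ω => c j * (W (τ (j + 1)) ω - W (τ j) ω))
    (fun j _ => (hm j).const_mul _) hind'
  rw [h, Finset.prod_apply]
  have hj : ∀ j, charFun (P.map fun ω => c j * (W (τ (j + 1)) ω - W (τ j) ω)) u =
      Complex.exp ((-(u ^ 2 * (c j ^ 2 * (τ (j + 1) - τ j)) / 2) : ℝ)) := by
    intro j
    rw [charFun_map_mul_comp (hm j)]
    have hl : P.map (fun ω => W (τ (j + 1)) ω - W (τ j) ω) = _ :=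
      (hW.hasLaw_sub (τ (j + 1)) (τ j)).map_eq
    rw [hl, charFun_gaussianReal]
    have hd : ((nndist (τ (j + 1)).1 (τ j).1 : ℝ≥0) : ℝ) = τ (j + 1) - τ j := by
      rw [coe_nndist, Real.dist_eq]
      exact abs_of_nonneg (sub_nonneg.2 (by exact_mod_cast hτ (Nat.le_succ j)))
    rw [hd]
    congr 1
    push_cast
    ring
  simp_rw [hj]
  rw [← Complex.exp_sum, ← Complex.ofReal_sum]
  congr 2
  rw [Finset.sum_neg_distrib, Finset.mul_sum, Finset.sum_div]

/-- A weighted sum of increments of a Brownian motion is centred Gaussian. -/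
theorem charFun_map_sum_increments [IsProbabilityMeasure P] (hB : IsBrownianMotion B P)
    {τ : ℕ → ℝ≥0} (hτ : Monotone τ) (c : ℕ → ℝ) (L : ℕ) (ξ : EuclideanSpace ℝ (Fin d)) :
    charFun (P.map fun ω => ∑ j ∈ Finset.range L, c j • (B (τ (j + 1)) ω - B (τ j) ω)) ξ =
      Complex.exp
        ((-(‖ξ‖ ^ 2 * (∑ j ∈ Finset.range L, c j ^ 2 * (τ (j + 1) - τ j)) / 2) : ℝ)) := by
  set φ : (ℝ≥0 → ℝ) → ℝ := fun b => ∑ j ∈ Finset.range L, c j * (b (τ (j + 1)) - b (τ j)) with hφ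
  have hφm : Measurable φ := by
    rw [hφ]
    fun_prop
  have hind := hB.indep.comp (fun _ => φ) fun _ => hφm
  have hm : ∀ i : Fin d, AEMeasurable (φ ∘ fun ω t => B t ω i) P := by
    intro i
    refine (hφm.comp (measurable_pi_lambda _ fun t => ?_)).aemeasurable
    have := hB.measurable t
    fun_prop
  have h := (iIndepFun_iff_charFun_pi hm).1 hind ξ
  have e : (fun ω => ∑ j ∈ Finset.range L, c j • (B (τ (j + 1)) ω - B (τ j) ω)) =
      fun ω => WithLp.toLp 2 fun i => (φ ∘ fun ω t => B t ω i) ω := by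
    ext ω i
    simp [hφ]
  rw [e, h]
  have hi : ∀ i : Fin d, charFun (P.map (φ ∘ fun ω t => B t ω i)) (ξ i) = _ := fun i =>
    charFun_map_sum_increments_real (hB.coord i).toIsPreBrownianReal hτ c L (ξ i)
  simp_rw [hi]
  rw [← Complex.exp_sum, ← Complex.ofReal_sum]
  congr 2
  rw [EuclideanSpace.real_norm_sq_eq, Finset.sum_neg_distrib, Finset.sum_mul, Finset.sum_div]

/-- A weighted sum of increments of `B` adds to an independent random variable an independent
Gaussian part. -/
theorem charFun_map_add_sum_increments [IsProbabilityMeasure P] (hB : IsBrownianMotion B P)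
    {X₀ : Ω → EuclideanSpace ℝ (Fin d)} (hX₀ : AEMeasurable X₀ P)
    (hind : IndepFun X₀ (fun (ω : Ω) (t : ℝ≥0) => B t ω) P)
    {τ : ℕ → ℝ≥0} (hτ : Monotone τ) (c : ℕ → ℝ) (L : ℕ) (ξ : EuclideanSpace ℝ (Fin d)) :
    charFun (P.map fun ω =>
        X₀ ω + ∑ j ∈ Finset.range L, c j • (B (τ (j + 1)) ω - B (τ j) ω)) ξ =
      charFun (P.map X₀) ξ * Complex.exp
        ((-(‖ξ‖ ^ 2 * (∑ j ∈ Finset.range L, c j ^ 2 * (τ (j + 1) - τ j)) / 2) : ℝ)) := by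
  set φ : (ℝ≥0 → EuclideanSpace ℝ (Fin d)) → EuclideanSpace ℝ (Fin d) :=
    fun b => ∑ j ∈ Finset.range L, c j • (b (τ (j + 1)) - b (τ j)) with hφ
  have hφm : Measurable φ := by
    rw [hφ]
    fun_prop
  have h := hind.comp measurable_id hφm
  have hBm : Measurable fun (ω : Ω) (t : ℝ≥0) => B t ω :=
    measurable_pi_lambda _ fun t => hB.measurable t
  have h' := IndepFun.charFun_map_fun_add_eq_mul hX₀ (hφm.comp hBm).aemeasurable h
  have := congrFun h' ξ
  rw [Pi.mul_apply] at this
  refine this.trans ?_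
  congr 1
  exact charFun_map_sum_increments hB hτ c L ξ

end Brownian

/-! ### The scaling function -/

section MeanScale

variable {T σ : ℝ} {β : ℝ → ℝ}

theorem meanScale_pos (t : ℝ) : 0 < meanScale σ β t := Real.exp_pos _

theorem meanScale_zero : meanScale σ β 0 = 1 := by simp [meanScale]

theorem intervalIntegrable_of_continuousOn_Icc {E : Type*} [NormedAddCommGroup E] {f : ℝ → E}
    (hf : ContinuousOn f (Icc 0 T)) {x y : ℝ} (hx : x ∈ Icc 0 T) (hy : y ∈ Icc 0 T) :
    IntervalIntegrable f volume x y :=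
  (hf.mono ((convex_Icc 0 T).ordConnected.uIcc_subset hx hy)).intervalIntegrable

theorem continuousOn_meanScale (hT : 0 ≤ T) (hβ : ContinuousOn β (Icc 0 T)) :
    ContinuousOn (meanScale σ β) (Icc 0 T) := by
  have h : ContinuousOn (fun x => ∫ s in (0 : ℝ)..x, β s) (Icc 0 T) := by
    rw [← uIcc_of_le hT] at hβ ⊢
    exact intervalIntegral.continuousOn_primitive_interval
      (hβ.integrableOn_compact isCompact_uIcc)
  exact (h.const_mul _).rexp

theorem hasDerivAt_inv_meanScale (hβ : ContinuousOn β (Icc 0 T)) {x : ℝ} (hx : x ∈ Ioo 0 T) :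
    HasDerivAt (fun s => (meanScale σ β s)⁻¹) (β x / (2 * σ ^ 2) * (meanScale σ β x)⁻¹) x := by
  have hT : 0 ≤ T := (hx.1.trans hx.2).le
  have h1 : HasDerivAt (fun y => ∫ s in (0 : ℝ)..y, β s) (β x) x :=
    intervalIntegral.integral_hasDerivAt_right
      (intervalIntegrable_of_continuousOn_Icc hβ ⟨le_rfl, hT⟩ (Ioo_subset_Icc_self hx))
      ((hβ.mono Ioo_subset_Icc_self).stronglyMeasurableAtFilter isOpen_Ioo x hx)
      (hβ.continuousAt (Icc_mem_nhds hx.1 hx.2))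
  have h2 := (h1.const_mul (1 / (2 * σ ^ 2))).exp
  have e : ∀ s, (meanScale σ β s)⁻¹ = Real.exp (1 / (2 * σ ^ 2) * ∫ u in (0 : ℝ)..s, β u) := by
    intro s
    rw [meanScale, ← Real.exp_neg]
    congr 1
    ring
  simp_rw [e]
  convert h2 using 1
  ring

theorem continuousOn_inv_meanScale (hT : 0 ≤ T) (hβ : ContinuousOn β (Icc 0 T)) :
    ContinuousOn (fun s => (meanScale σ β s)⁻¹) (Icc 0 T) :=
  (continuousOn_meanScale hT hβ).inv₀ fun s _ => (meanScale_pos s).ne'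

theorem integral_mul_inv_meanScale (hβ : ContinuousOn β (Icc 0 T)) {x y : ℝ} (hx : 0 ≤ x)
    (hxy : x ≤ y) (hy : y ≤ T) :
    ∫ s in x..y, β s / (2 * σ ^ 2) * (meanScale σ β s)⁻¹ =
      (meanScale σ β y)⁻¹ - (meanScale σ β x)⁻¹ := by
  have hT : 0 ≤ T := hx.trans (hxy.trans hy)
  have hw := continuousOn_inv_meanScale (σ := σ) hT hβ
  refine intervalIntegral.integral_eq_sub_of_hasDerivAt_of_le hxy
    (hw.mono (Icc_subset_Icc hx hy))
    (fun s hs => hasDerivAt_inv_meanScale hβ ⟨hx.trans_lt hs.1, hs.2.trans_le hy⟩)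
    (intervalIntegrable_of_continuousOn_Icc ((hβ.div_const _).mul hw) ⟨hx, hxy.trans hy⟩
      ⟨hx.trans hxy, hy⟩)

theorem integral_mul_inv_meanScale_sq (hσ : 0 < σ) (hβ : ContinuousOn β (Icc 0 T)) {t : ℝ}
    (ht : t ∈ Icc 0 T) :
    ∫ s in (0 : ℝ)..t, (meanScale σ β s)⁻¹ ^ 2 * β s =
      σ ^ 2 * ((meanScale σ β t)⁻¹ ^ 2 - 1) := by
  have hT : 0 ≤ T := ht.1.trans ht.2
  have hw := continuousOn_inv_meanScale (σ := σ) hT hβ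
  have h := intervalIntegral.integral_eq_sub_of_hasDerivAt_of_le
    (f := fun s => σ ^ 2 * (meanScale σ β s)⁻¹ ^ 2)
    (f' := fun s => (meanScale σ β s)⁻¹ ^ 2 * β s) ht.1
    (((hw.pow 2).const_mul _).mono (Icc_subset_Icc le_rfl ht.2))
    (fun s hs => ?_)
    (intervalIntegrable_of_continuousOn_Icc ((hw.pow 2).mul hβ) ⟨le_rfl, hT⟩ ht)
  · rw [h]
    simp [meanScale_zero]
    ring
  · refine (((hasDerivAt_inv_meanScale hβ ⟨hs.1, hs.2.trans_le ht.2⟩).pow 2).const_mul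
      (σ ^ 2)).congr_deriv ?_
    push_cast
    field_simp

theorem meanScale_lt_one (hσ : 0 < σ) (hβ : ContinuousOn β (Icc 0 T))
    (hpos : ∀ t ∈ Icc 0 T, 0 < β t) {t : ℝ} (ht : t ∈ Ioc 0 T) : meanScale σ β t < 1 := by
  have h : 0 < ∫ s in (0 : ℝ)..t, β s :=
    intervalIntegral.intervalIntegral_pos_of_pos_on
      (intervalIntegrable_of_continuousOn_Icc hβ ⟨le_rfl, ht.1.le.trans ht.2⟩
        (Ioc_subset_Icc_self ht))
      (fun s hs => hpos s ⟨hs.1.le, hs.2.le.trans ht.2⟩) ht.1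
  rw [meanScale, Real.exp_lt_one_iff]
  have : 0 < 1 / (2 * σ ^ 2) := by positivity
  nlinarith

end MeanScale

/-! ### The law of the forward process -/

/-- The noise part `X_t - X_0 + ∫₀ᵗ β(s) / (2σ²) X_s ds` of the forward process. It is a version
of `∫₀ᵗ √β dB` whose paths are continuous. -/
noncomputable def noisePart {Ω : Type*} {d : ℕ} (σ : ℝ) (β : ℝ → ℝ)
    (X : ℝ → Ω → EuclideanSpace ℝ (Fin d)) (t : ℝ) (ω : Ω) : EuclideanSpace ℝ (Fin d) :=
  X t ω - X 0 ω + ∫ s in (0 : ℝ)..t, (β s / (2 * σ ^ 2)) • X s ω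

/-- Summation by parts along a continuous path: in the limit of vanishing mesh,
`X_t / m_t - X_0` is the integral of `1 / m` against the noise part. -/
theorem tendsto_sum_smul_noisePart {Ω : Type*} {d : ℕ} {T σ : ℝ} {β : ℝ → ℝ}
    {X : ℝ → Ω → EuclideanSpace ℝ (Fin d)} (hβ : ContinuousOn β (Icc 0 T)) {t : ℝ}
    (ht : t ∈ Icc 0 T) {ω : Ω} (hω : ContinuousOn (fun t => X t ω) (Icc 0 T)) :
    Tendsto (fun N : ℕ => X 0 ω + ∑ k ∈ Finset.range N, (meanScale σ β (t * k / N))⁻¹ •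
      (noisePart σ β X (t * (k + 1 : ℕ) / N) ω - noisePart σ β X (t * k / N) ω)) atTop
      (𝓝 ((meanScale σ β t)⁻¹ • X t ω)) := by
  have hT : 0 ≤ T := ht.1.trans ht.2
  have hsub : Icc 0 t ⊆ Icc 0 T := Icc_subset_Icc le_rfl ht.2
  have hw := continuousOn_inv_meanScale (σ := σ) hT hβ
  set w : ℝ → ℝ := fun s => (meanScale σ β s)⁻¹ with hwdef
  set a : ℝ → ℝ := fun s => β s / (2 * σ ^ 2) with hadef
  have ha : ContinuousOn a (Icc 0 T) := hβ.div_const _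
  have c1 : MapsTo (fun p : ℝ × ℝ × ℝ => p.1) (Icc 0 t ×ˢ Icc 0 t ×ˢ Icc 0 t) (Icc 0 T) :=
    fun p hp => hsub hp.1
  have c2 : MapsTo (fun p : ℝ × ℝ × ℝ => p.2.1) (Icc 0 t ×ˢ Icc 0 t ×ˢ Icc 0 t) (Icc 0 T) :=
    fun p hp => hsub hp.2.1
  have c3 : MapsTo (fun p : ℝ × ℝ × ℝ => p.2.2) (Icc 0 t ×ˢ Icc 0 t ×ˢ Icc 0 t) (Icc 0 T) :=
    fun p hp => hsub hp.2.2
  have f1 : ContinuousOn (fun p : ℝ × ℝ × ℝ => p.1) (Icc 0 t ×ˢ Icc 0 t ×ˢ Icc 0 t) := by fun_prop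
  have f2 : ContinuousOn (fun p : ℝ × ℝ × ℝ => p.2.1) (Icc 0 t ×ˢ Icc 0 t ×ˢ Icc 0 t) := by
    fun_prop
  have f3 : ContinuousOn (fun p : ℝ × ℝ × ℝ => p.2.2) (Icc 0 t ×ˢ Icc 0 t ×ˢ Icc 0 t) := by
    fun_prop
  have hG := tendsto_sum_integral_of_diag_zero ht.1
    (G := fun p : ℝ × ℝ × ℝ => (a p.2.2 * w p.2.2) • X p.2.1 ω - w p.1 • (a p.2.2 • X p.2.2 ω))
    ((((ha.comp f3 c3).mul (hw.comp f3 c3)).smul (hω.comp f2 c2)).sub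
      ((hw.comp f1 c1).smul ((ha.comp f3 c3).smul (hω.comp f3 c3))))
    (fun s _ => by
      simp only []
      rw [smul_smul, mul_comm, sub_self])
  have hlim := hG.const_sub (w t • X t ω)
  rw [sub_zero] at hlim
  refine hlim.congr' ?_
  filter_upwards [eventually_ne_atTop 0] with N hN
  have hN' : (N : ℝ) ≠ 0 := by exact_mod_cast hN
  have htel : w t • X t ω - X 0 ω = ∑ k ∈ Finset.range N,
      (w (t * (k + 1 : ℕ) / N) • X (t * (k + 1 : ℕ) / N) ω - w (t * k / N) • X (t * k / N) ω) := by
    rw [Finset.sum_range_sub (fun k : ℕ => w (t * k / N) • X (t * k / N) ω)]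
    simp [mul_div_assoc, div_self hN', hwdef, meanScale_zero]
  rw [sub_eq_iff_eq_add, add_assoc, ← sub_eq_iff_eq_add', htel, ← Finset.sum_add_distrib]
  refine Finset.sum_congr rfl fun k hk => ?_
  have hk' := Finset.mem_range.1 hk
  have hx := hsub (partition_mem_Icc ht.1 hk'.le)
  have hy := hsub (partition_mem_Icc ht.1 (hk' : k + 1 ≤ N))
  have hxy : t * k / N ≤ t * (k + 1 : ℕ) / N := by
    have := ht.1
    push_cast
    gcongr
    linarith
  have hcast : t * ((k : ℝ) + 1) / N = t * (k + 1 : ℕ) / N := by push_cast; rfl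
  rw [hcast]
  set x := t * k / N
  set y := t * (k + 1 : ℕ) / N
  have h0 : (0 : ℝ) ∈ Icc 0 T := ⟨le_rfl, hT⟩
  have haX : ContinuousOn (fun s => a s • X s ω) (Icc 0 T) := ha.smul hω
  have hM : noisePart σ β X y ω - noisePart σ β X x ω =
      X y ω - X x ω + ∫ s in x..y, a s • X s ω := by
    rw [← intervalIntegral.integral_interval_sub_left
      (intervalIntegrable_of_continuousOn_Icc haX h0 hy)
      (intervalIntegrable_of_continuousOn_Icc haX h0 hx)]
    simp only [noisePart, hadef]
    abel
  have haw : ContinuousOn (fun s => a s * w s) (Icc 0 T) := ha.mul hw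
  have hi1 : IntervalIntegrable (fun s => (a s * w s) • X y ω) volume x y :=
    intervalIntegrable_of_continuousOn_Icc (haw.smul continuousOn_const) hx hy
  have hi2 : IntervalIntegrable (fun s => w x • a s • X s ω) volume x y :=
    intervalIntegrable_of_continuousOn_Icc (haX.const_smul (w x)) hx hy
  rw [hM, intervalIntegral.integral_sub hi1 hi2,
    intervalIntegral.integral_smul_const, intervalIntegral.integral_smul,
    integral_mul_inv_meanScale hβ hx.1 hxy hy.2]
  change _ = w x • _ + ((w y - w x) • X y ω - _)
  module

/-- On the subinterval `[0, kt/N]` with `kn` steps, the left-point sum uses the first `kn` points of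
the uniform partition of `[0, t]` into `Nn` steps. -/
theorem itoSum_partition {Ω : Type*} {d : ℕ} {B : ℝ≥0 → Ω → EuclideanSpace ℝ (Fin d)}
    (f : ℝ → ℝ) {t : ℝ} (k N n : ℕ) (ω : Ω) :
    itoSum f B (t * k / N) (k * n) ω = ∑ j ∈ Finset.range (k * n), f (t * j / (N * n : ℕ)) •
      (B (Real.toNNReal (t * (j + 1 : ℕ) / (N * n : ℕ))) ω -
        B (Real.toNNReal (t * j / (N * n : ℕ))) ω) := by
  rcases Nat.eq_zero_or_pos k with rfl | hk
  · simp [itoSum]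
  have hk' : (k : ℝ) ≠ 0 := by exact_mod_cast hk.ne'
  have e : ∀ r : ℝ, t * k / N * r / (k * n : ℕ) = t * r / (N * n : ℕ) := by
    intro r
    push_cast
    field_simp
  unfold itoSum
  simp only [e]
  push_cast
  rfl

section ForwardProcess

variable {Ω : Type*} [MeasurableSpace Ω] {P : Measure Ω} {d : ℕ}
  {T σ : ℝ} {β : ℝ → ℝ} {π₀ : Measure (EuclideanSpace ℝ (Fin d))}
  {B : ℝ≥0 → Ω → EuclideanSpace ℝ (Fin d)} {X : ℝ → Ω → EuclideanSpace ℝ (Fin d)}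

theorem IsForwardProcess.isItoIntegral_noisePart (hX : IsForwardProcess T σ β π₀ B X P) {t : ℝ}
    (ht : t ∈ Icc 0 T) :
    IsItoIntegral (fun s => Real.sqrt (β s)) B t (noisePart σ β X t) P := by
  obtain ⟨I, hI, hXI⟩ := hX.sde t ht
  refine TendstoInMeasure.congr_right ?_ hI
  filter_upwards [hXI] with ω hω
  rw [noisePart, hω]
  abel

/-- Adding to `X₀` the integral against the noise part of a weight `w` that is constant on each
interval of the uniform partition of `[0, t]` into `N` steps multiplies the characteristic function
by that of `𝒩(0, v I)`, where `v = ∫₀ᵗ w² β`. The left-point sums on the intervals `[0, kt/N]` are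
taken with `kn` steps, so that they all use one partition of `[0, t]`, into `Nn` steps; then
`n → ∞`. -/
theorem IsForwardProcess.charFun_map_add_sum [IsProbabilityMeasure P]
    (hX : IsForwardProcess T σ β π₀ B X P)
    (hβ : ContinuousOn β (Icc 0 T)) (hpos : ∀ t ∈ Icc 0 T, 0 < β t) {t : ℝ} (ht : t ∈ Icc 0 T)
    {N : ℕ} (hN : N ≠ 0) (w : ℕ → ℝ) :
    AEMeasurable (fun ω => X 0 ω + ∑ k ∈ Finset.range N, w k •
      (noisePart σ β X (t * (k + 1 : ℕ) / N) ω - noisePart σ β X (t * k / N) ω)) P ∧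
    ∀ ξ, charFun (P.map fun ω => X 0 ω + ∑ k ∈ Finset.range N, w k •
      (noisePart σ β X (t * (k + 1 : ℕ) / N) ω - noisePart σ β X (t * k / N) ω)) ξ =
      charFun π₀ ξ * Complex.exp ((-(‖ξ‖ ^ 2 * (∑ k ∈ Finset.range N, w k ^ 2 *
        ∫ s in (t * k / N)..(t * (k + 1) / N), β s) / 2) : ℝ)) := by
  have hT : 0 ≤ T := ht.1.trans ht.2
  set f : ℝ → ℝ := fun s => Real.sqrt (β s) with hf
  have hmem : ∀ {k : ℕ}, k ≤ N → t * k / N ∈ Icc 0 T := fun hk =>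
    Icc_subset_Icc le_rfl ht.2 (partition_mem_Icc ht.1 hk)
  have hmeas : ∀ k < N + 1, TendstoInMeasure P (fun n ω => itoSum f B (t * k / N) (k * n) ω) atTop
      (noisePart σ β X (t * k / N)) := by
    intro k hk
    rcases Nat.eq_zero_or_pos k with rfl | hk0
    -- for `k = 0` the left-point sums have no terms, and the noise part vanishes at time `0`
    · have h0 : noisePart σ β X (t * (0 : ℕ) / N) = fun _ => 0 := by
        ext1 ω
        simp [noisePart]
      rw [h0]
      simp only [itoSum, zero_mul, Finset.range_zero, Finset.sum_empty]
      exact tendstoInMeasure_of_tendsto_ae (fun _ => aestronglyMeasurable_const)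
        (Eventually.of_forall fun _ => tendsto_const_nhds)
    · exact (hX.isItoIntegral_noisePart (hmem (by omega))).comp
        (tendsto_id.const_mul_atTop' hk0)
  obtain ⟨ns, hns, hlim⟩ := exists_seq_tendsto_ae_of_forall_lt (N + 1) hmeas
  -- the approximating sums, along the subsequence shifted by one so that `n ≠ 0`
  set ms : ℕ → ℕ := fun i => ns (i + 1) with hms
  have hms0 : ∀ i, 0 < ms i := fun i => (Nat.zero_le _).trans_lt (hns (Nat.succ_pos i))
  have hmsT : Tendsto ms atTop atTop := hns.tendsto_atTop.comp (tendsto_add_atTop_nat 1)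
  set τ : ℕ → ℕ → ℝ≥0 := fun n j => Real.toNNReal (t * j / (N * n : ℕ)) with hτ
  have hτm : ∀ n, Monotone (τ n) := fun n i j hij => by
    refine Real.toNNReal_mono ?_
    have : (i : ℝ) ≤ j := by exact_mod_cast hij
    have := ht.1
    gcongr
  set c : ℕ → ℕ → ℝ := fun n j => w (j / n) * f (t * j / (N * n : ℕ)) with hc
  set Y : ℕ → Ω → EuclideanSpace ℝ (Fin d) := fun n ω => X 0 ω +
    ∑ j ∈ Finset.range (N * n), c n j • (B (τ n (j + 1)) ω - B (τ n j) ω) with hY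
  have hYm : ∀ n, AEMeasurable (Y n) P := by
    intro n
    refine (hX.initial.aemeasurable.add ?_)
    refine Measurable.aemeasurable (Finset.measurable_sum _ fun j _ => ?_)
    have h1 := hX.brownian.measurable (τ n (j + 1))
    have h2 := hX.brownian.measurable (τ n j)
    fun_prop
  have hYsum : ∀ n, 0 < n → ∀ ω, Y n ω = X 0 ω + ∑ k ∈ Finset.range N, w k •
      (itoSum f B (t * (k + 1 : ℕ) / N) ((k + 1) * n) ω - itoSum f B (t * k / N) (k * n) ω) := by
    intro n hn ω
    simp only [itoSum_partition]
    rw [sum_smul_block_sub w _ N hn]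
    simp only [hY, hc, hτ, mul_smul]
  have hYlim : ∀ᵐ ω ∂P, Tendsto (fun i => Y (ms i) ω) atTop (𝓝 (X 0 ω +
      ∑ k ∈ Finset.range N, w k • (noisePart σ β X (t * (k + 1 : ℕ) / N) ω -
        noisePart σ β X (t * k / N) ω))) := by
    have hall : ∀ᵐ ω ∂P, ∀ k, k < N + 1 → Tendsto (fun i => itoSum f B (t * k / N) (k * ns i) ω)
        atTop (𝓝 (noisePart σ β X (t * k / N) ω)) := by
      rw [ae_all_iff]
      intro k
      by_cases hk : k < N + 1
      · simpa [hk] using hlim k hk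
      · simp [hk]
    filter_upwards [hall] with ω hω
    simp_rw [hYsum _ (hms0 _)]
    refine tendsto_const_nhds.add (tendsto_finsetSum _ fun k hk => ?_)
    have hk' := Finset.mem_range.1 hk
    exact (((hω (k + 1) (by omega)).comp (tendsto_add_atTop_nat 1)).sub
      ((hω k (by omega)).comp (tendsto_add_atTop_nat 1))).const_smul _
  refine ⟨aemeasurable_of_tendsto_metrizable_ae atTop (fun i => hYm (ms i)) hYlim, fun ξ => ?_⟩
  have hchar := tendsto_charFun_map_of_tendsto_ae (fun i => hYm (ms i)) hYlim ξ
  have hvar : Tendsto (fun n : ℕ => ∑ j ∈ Finset.range (N * n),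
      c n j ^ 2 * ((τ n (j + 1) : ℝ) - τ n j)) atTop (𝓝 (∑ k ∈ Finset.range N, w k ^ 2 *
        ∫ s in (t * k / N)..(t * (k + 1) / N), β s)) := by
    have hR : ∀ k ≤ N, Tendsto (fun n : ℕ => ∑ j ∈ Finset.range (k * n),
        β (t * j / (N * n : ℕ)) * (t / (N * n : ℕ))) atTop
        (𝓝 (∫ s in (0 : ℝ)..(t * k / N), β s)) := by
      intro k hk
      rcases Nat.eq_zero_or_pos k with rfl | hk0
      · simp
      have h := (tendsto_riemannSum (hmem hk).1
        (hβ.mono (Icc_subset_Icc le_rfl (hmem hk).2))).comp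
        (tendsto_id.const_mul_atTop' hk0)
      refine h.congr fun n => ?_
      have hk' : (k : ℝ) ≠ 0 := by exact_mod_cast hk0.ne'
      simp only [Function.comp_apply, id]
      refine Finset.sum_congr rfl fun j _ => ?_
      have e1 : t * k / N * j / (k * n : ℕ) = t * j / (N * n : ℕ) := by
        push_cast
        field_simp
      have e2 : t * k / N / (k * n : ℕ) = t / (N * n : ℕ) := by
        push_cast
        field_simp
      rw [e1, e2]
    have hsum : Tendsto (fun n : ℕ => ∑ k ∈ Finset.range N, w k ^ 2 •
        (∑ j ∈ Finset.range ((k + 1) * n), β (t * j / (N * n : ℕ)) * (t / (N * n : ℕ)) -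
          ∑ j ∈ Finset.range (k * n), β (t * j / (N * n : ℕ)) * (t / (N * n : ℕ)))) atTop
        (𝓝 (∑ k ∈ Finset.range N, w k ^ 2 * ∫ s in (t * k / N)..(t * (k + 1) / N), β s)) := by
      refine tendsto_finsetSum _ fun k hk => ?_
      have hk' := Finset.mem_range.1 hk
      have h := ((hR (k + 1) hk').sub (hR k hk'.le)).const_mul (w k ^ 2)
      have h0 : (0 : ℝ) ∈ Icc 0 T := ⟨le_rfl, hT⟩
      have hs : (∫ s in (0 : ℝ)..(t * (k + 1 : ℕ) / N), β s) - ∫ s in (0 : ℝ)..(t * k / N), β s =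
          ∫ s in (t * k / N)..(t * (k + 1) / N), β s := by
        rw [intervalIntegral.integral_interval_sub_left
          (intervalIntegrable_of_continuousOn_Icc hβ h0 (hmem hk'))
          (intervalIntegrable_of_continuousOn_Icc hβ h0 (hmem hk'.le))]
        push_cast
        rfl
      rw [hs] at h
      exact h
    refine hsum.congr' ?_
    filter_upwards [eventually_gt_atTop 0] with n hn
    rw [sum_smul_block_sub (fun k => w k ^ 2) _ N hn]
    refine Finset.sum_congr rfl fun j hj => ?_
    have hj' := Finset.mem_range.1 hj
    have hjm : t * j / (N * n : ℕ) ∈ Icc 0 T :=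
      Icc_subset_Icc le_rfl ht.2 (partition_mem_Icc ht.1 hj'.le)
    have hjm' : t * (j + 1 : ℕ) / (N * n : ℕ) ∈ Icc 0 T :=
      Icc_subset_Icc le_rfl ht.2 (partition_mem_Icc ht.1 hj')
    simp only [hc, hτ, hf]
    rw [Real.coe_toNNReal _ hjm.1, Real.coe_toNNReal _ hjm'.1, mul_pow,
      Real.sq_sqrt (hpos _ hjm).le, smul_eq_mul]
    push_cast
    ring
  have hchar' : Tendsto (fun i => charFun (P.map (Y (ms i))) ξ) atTop
      (𝓝 (charFun π₀ ξ * Complex.exp ((-(‖ξ‖ ^ 2 * (∑ k ∈ Finset.range N, w k ^ 2 *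
        ∫ s in (t * k / N)..(t * (k + 1) / N), β s) / 2) : ℝ)))) := by
    have e : ∀ n, charFun (P.map (Y n)) ξ = charFun π₀ ξ * Complex.exp
        ((-(‖ξ‖ ^ 2 * (∑ j ∈ Finset.range (N * n),
          c n j ^ 2 * ((τ n (j + 1) : ℝ) - τ n j)) / 2) : ℝ)) := by
      intro n
      rw [← hX.initial.map_eq]
      exact charFun_map_add_sum_increments hX.brownian hX.initial.aemeasurable hX.indep (hτm n)
        (c n) (N * n) ξ
    simp_rw [e]
    have hcont : Continuous fun v : ℝ =>
        charFun π₀ ξ * Complex.exp ((-(‖ξ‖ ^ 2 * v / 2) : ℝ)) := by fun_prop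
    exact (hcont.tendsto _).comp (hvar.comp hmsT)
  exact tendsto_nhds_unique hchar hchar'

/-- The characteristic function of the law of `X_t`: that of `m_t X_0` times that of
`𝒩(0, σ² (1 - m_t²) I)`. -/
theorem IsForwardProcess.charFun_map [IsProbabilityMeasure P]
    (hX : IsForwardProcess T σ β π₀ B X P) (hσ : 0 < σ)
    (hβ : ContinuousOn β (Icc 0 T)) (hpos : ∀ t ∈ Icc 0 T, 0 < β t) {t : ℝ} (ht : t ∈ Icc 0 T)
    (ξ : EuclideanSpace ℝ (Fin d)) :
    charFun (P.map (X t)) ξ = charFun π₀ (meanScale σ β t • ξ) * Complex.exp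
      ((-(‖ξ‖ ^ 2 * (σ ^ 2 * (1 - meanScale σ β t ^ 2)) / 2) : ℝ)) := by
  have hT : 0 ≤ T := ht.1.trans ht.2
  have hw := continuousOn_inv_meanScale (σ := σ) hT hβ
  have hsub : Icc 0 t ⊆ Icc 0 T := Icc_subset_Icc le_rfl ht.2
  have hm := meanScale_pos (σ := σ) (β := β) t
  set w : ℝ → ℝ := fun s => (meanScale σ β s)⁻¹ with hwdef
  -- `X_t / m_t` at frequency `m_t ξ` has the same characteristic function as `X_t` at `ξ`
  set η := meanScale σ β t • ξ with hη
  have hlaw := fun N : ℕ => hX.charFun_map_add_sum hβ hpos ht (Nat.succ_ne_zero N)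
    (fun k => w (t * k / (N + 1 : ℕ)))
  have hpath : ∀ᵐ ω ∂P, Tendsto (fun N : ℕ => X 0 ω + ∑ k ∈ Finset.range (N + 1),
      w (t * k / (N + 1 : ℕ)) • (noisePart σ β X (t * (k + 1 : ℕ) / (N + 1 : ℕ)) ω -
        noisePart σ β X (t * k / (N + 1 : ℕ)) ω)) atTop (𝓝 (w t • X t ω)) := by
    filter_upwards [hX.continuous] with ω hω
    exact (tendsto_sum_smul_noisePart hβ ht hω).comp (tendsto_add_atTop_nat 1)
  have h1 := tendsto_charFun_map_of_tendsto_ae (fun N => (hlaw N).1) hpath η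
  simp_rw [fun N => (hlaw N).2 η] at h1
  have hvar : Tendsto (fun N : ℕ => ∑ k ∈ Finset.range N, w (t * k / N) ^ 2 *
      ∫ s in (t * k / N)..(t * (k + 1) / N), β s) atTop
      (𝓝 (σ ^ 2 * (w t ^ 2 - 1))) := by
    have hG := tendsto_sum_integral_of_diag_zero ht.1
      (G := fun p : ℝ × ℝ × ℝ => w p.1 ^ 2 * β p.2.2 - w p.2.2 ^ 2 * β p.2.2)
      ((((hw.comp continuousOn_fst fun p hp => hsub hp.1).pow 2).mul
        (hβ.comp (continuousOn_snd.comp continuousOn_snd fun p hp => hp.2)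
          fun p hp => hsub hp.2.2)).sub
        (((hw.pow 2).mul hβ).comp (continuousOn_snd.comp continuousOn_snd fun p hp => hp.2)
          fun p hp => hsub hp.2.2))
      (fun s _ => sub_self _)
    have hG' := hG.add_const (∫ s in (0 : ℝ)..t, w s ^ 2 * β s)
    rw [zero_add, integral_mul_inv_meanScale_sq hσ hβ ht] at hG'
    refine hG'.congr' ?_
    filter_upwards [eventually_ne_atTop 0] with N hN
    have hwβ : ContinuousOn (fun s => w s ^ 2 * β s) (Icc 0 T) := (hw.pow 2).mul hβ
    rw [← integral_mul_inv_meanScale_sq hσ hβ ht, ← sum_integral_partition ht.1 (hwβ.mono hsub) hN,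
      ← Finset.sum_add_distrib]
    refine Finset.sum_congr rfl fun k hk => ?_
    have hk' := Finset.mem_range.1 hk
    have hx := hsub (partition_mem_Icc ht.1 hk'.le)
    have hy := hsub (partition_mem_Icc ht.1 (hk' : k + 1 ≤ N))
    push_cast at hy
    rw [intervalIntegral.integral_sub
      (intervalIntegrable_of_continuousOn_Icc (hβ.const_mul _) hx hy)
      (intervalIntegrable_of_continuousOn_Icc hwβ hx hy), sub_add_cancel,
      intervalIntegral.integral_const_mul]
  have hcont : Continuous fun v : ℝ =>
      charFun π₀ η * Complex.exp ((-(‖η‖ ^ 2 * v / 2) : ℝ)) := by fun_prop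
  have h2 := (hcont.tendsto _).comp (hvar.comp (tendsto_add_atTop_nat 1))
  have h3 := tendsto_nhds_unique h1 h2
  rw [charFun_map_smul_comp (hX.measurable t ht).aemeasurable, hη, smul_smul] at h3
  have hwm : w t * meanScale σ β t = 1 := inv_mul_cancel₀ hm.ne'
  rw [hwm, one_smul] at h3
  rw [h3]
  congr 4
  rw [norm_smul, Real.norm_of_nonneg hm.le]
  have : meanScale σ β t ^ 2 * w t ^ 2 = 1 := by rw [← mul_pow, mul_comm, hwm, one_pow]
  linear_combination ‖ξ‖ ^ 2 * σ ^ 2 / 2 * this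

end ForwardProcess

/-! ### The concavity constant -/

section Constant

variable {T σ C : ℝ} {β : ℝ → ℝ}

theorem concavityConst_zero : concavityConst σ β C 0 = C - 1 / σ ^ 2 := by
  rw [concavityConst, meanScale_zero]
  simp

theorem concavityConst_mem_Icc (hσ : 0 < σ) (hC : 1 / σ ^ 2 < C)
    (hpos : ∀ t ∈ Icc 0 T, 0 < β t) {t : ℝ} (ht : t ∈ Icc 0 T) :
    concavityConst σ β C t ∈ Icc 0 (C - 1 / σ ^ 2) := by
  have hσ2 : 0 < σ ^ 2 := by positivity
  have hC0 : 0 < C := lt_trans (by positivity) hC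
  have hm := meanScale_pos (σ := σ) (β := β) t
  have hm1 : meanScale σ β t ≤ 1 := by
    rw [meanScale, Real.exp_le_one_iff]
    have h1 : 0 ≤ ∫ s in (0 : ℝ)..t, β s :=
      intervalIntegral.integral_nonneg ht.1 fun s hs => (hpos s ⟨hs.1, hs.2.trans ht.2⟩).le
    have h2 : 0 ≤ 1 / (2 * σ ^ 2) := by positivity
    nlinarith
  have hM0 : 0 < meanScale σ β t ^ 2 := by positivity
  have hM1 : meanScale σ β t ^ 2 ≤ 1 := pow_le_one₀ hm.le hm1
  -- the denominator below is a convex combination of `1 / C` and `σ²`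
  have hCs : 1 / C < σ ^ 2 := (one_div_lt hσ2 hC0).1 hC
  rw [concavityConst, show ∀ M : ℝ, M / C = M * (1 / C) from fun M => by ring]
  set M := meanScale σ β t ^ 2
  have hC1 : 0 < 1 / C := by positivity
  have hlo : 1 / C ≤ M * (1 / C) + σ ^ 2 * (1 - M) := by nlinarith
  have hhi : M * (1 / C) + σ ^ 2 * (1 - M) ≤ σ ^ 2 := by nlinarith
  refine ⟨sub_nonneg.2 (one_div_le_one_div_of_le (hC1.trans_le hlo) hhi),
    sub_le_sub_right ?_ _⟩
  rw [one_div_le (hC1.trans_le hlo) hC0]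
  exact hlo

end Constant

/-! ### Densities of the forward process and their concavity -/

theorem mainTheorem8 {Ω : Type*} [MeasurableSpace Ω] (P : Measure Ω) [IsProbabilityMeasure P]
    {d : ℕ} (T σ Cstar : ℝ) (hT : 0 < T) (hσ : 0 < σ)
    (β : ℝ → ℝ) (hβcont : ContinuousOn β (Icc 0 T)) (hβmono : MonotoneOn β (Icc 0 T))
    (hβpos : ∀ t ∈ Icc 0 T, 0 < β t)
    (p₀ : EuclideanSpace ℝ (Fin d) → ℝ) (hp₀ : Measurable p₀)
    (hconc : IsStronglyLogConcave Cstar p₀) (hC : 1 / σ ^ 2 < Cstar)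
    (B : ℝ≥0 → Ω → EuclideanSpace ℝ (Fin d)) (X : ℝ → Ω → EuclideanSpace ℝ (Fin d))
    (hX : IsForwardProcess T σ β (densityMeasure p₀) B X P) :
    (∀ t ∈ Ioc 0 T, ∃ p : EuclideanSpace ℝ (Fin d) → ℝ,
      (∀ x, 0 < p x) ∧ Differentiable ℝ p ∧ HasLaw (X t) (densityMeasure p) P ∧
      StrongConcaveOn univ (concavityConst σ β Cstar t)
        (fun x => Real.log (renormalized σ p x)) ∧
      ∀ x y : EuclideanSpace ℝ (Fin d),
        concavityConst σ β Cstar t * ‖x - y‖ ^ 2 ≤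
          inner ℝ (gradient (fun z => Real.log (renormalized σ p z)) y -
            gradient (fun z => Real.log (renormalized σ p z)) x) (x - y)) ∧
    IsStronglyLogConcave (concavityConst σ β Cstar 0) (renormalized σ p₀) ∧
    ∀ t ∈ Icc 0 T, 0 ≤ concavityConst σ β Cstar t ∧
      concavityConst σ β Cstar t ≤ Cstar - 1 / σ ^ 2 := by
  have hC0 : 0 < Cstar := lt_trans (by positivity) hC
  have hprob : IsProbabilityMeasure (densityMeasure p₀) := by
    rw [← hX.initial.map_eq]
    exact Measure.isProbabilityMeasure_map hX.initial.aemeasurable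
  refine ⟨fun t ht => ?_, ?_, fun t ht => concavityConst_mem_Icc hσ hC hβpos ht⟩
  · have htI : t ∈ Icc 0 T := Ioc_subset_Icc_self ht
    have hm := meanScale_pos (σ := σ) (β := β) t
    have hm1 := meanScale_lt_one hσ hβcont hβpos ht
    have hv : 0 < σ ^ 2 * (1 - meanScale σ β t ^ 2) :=
      mul_pos (by positivity) (sub_pos.2 (pow_lt_one₀ hm.le hm1 two_ne_zero))
    set s := Real.sqrt (σ ^ 2 * (1 - meanScale σ β t ^ 2)) with hs
    have hs0 : 0 < s := Real.sqrt_pos.2 hv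
    have hs2 : s ^ 2 = σ ^ 2 * (1 - meanScale σ β t ^ 2) := Real.sq_sqrt hv.le
    set p := smoothedDensity (meanScale σ β t) s (densityMeasure p₀) with hp
    have hpos : ∀ x, 0 < p x := fun x => smoothedDensity_pos hs0 x
    have hdiff : Differentiable ℝ p := differentiable_smoothedDensity hs0
    have hconcave : StrongConcaveOn univ (concavityConst σ β Cstar t)
        (fun x => Real.log (renormalized σ p x)) := by
      have h := strongConcaveOn_log_smoothedDensity (m := meanScale σ β t) hC0 hs0 hp₀ hconc
      have hu : {x | 0 < p x} = univ := eq_univ_of_forall hpos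
      rw [hs2, ← hu] at h
      rw [← hu]
      exact strongConcaveOn_log_renormalized hσ h
    refine ⟨p, hpos, hdiff, ⟨(hX.measurable t htI).aemeasurable, ?_⟩, hconcave,
      hconcave.mul_norm_sq_le_inner_gradient ?_⟩
    · have := isProbabilityMeasure_densityMeasure_smoothedDensity
        (m := meanScale σ β t) (μ := densityMeasure p₀) hs0
      have : IsProbabilityMeasure (P.map (X t)) :=
        Measure.isProbabilityMeasure_map (hX.measurable t htI).aemeasurable
      refine Measure.ext_of_charFun (funext fun ξ => ?_)
      rw [hX.charFun_map hσ hβcont hβpos htI, hp, charFun_densityMeasure_smoothedDensity hs0, hs2]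
    · have e : (fun x => Real.log (renormalized σ p x)) = fun x => Real.log (p x) +
          1 / σ ^ 2 / 2 * ‖x‖ ^ 2 - Real.log ((2 * Real.pi * σ ^ 2) ^ (-(d : ℝ) / 2)) :=
        funext fun x => log_renormalized hσ (hpos x)
      rw [e]
      exact ((hdiff.log fun x => (hpos x).ne').add
        ((differentiable_id.norm_sq ℝ).const_mul _)).sub_const _
  · have hset : {x | 0 < renormalized σ p₀ x} = {x | 0 < p₀ x} := by
      ext x
      exact div_pos_iff_of_pos_right (gaussianDensity_pos hσ x)
    refine ⟨fun x => div_nonneg (hconc.1 x) (gaussianDensity_pos hσ x).le, ?_⟩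
    rw [hset, concavityConst_zero]
    exact strongConcaveOn_log_renormalized hσ hconc.2
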